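/- Formulas are built from countably many variables with $\neg$ and $\to$. For $n\ge 1$ let $\mathbf{ŁV}_{n+1}$ be the algebra on $\{0,\frac1n,\dots,\frac{n-1}n,1\}$ with $\neg x=1-x$ and $x\to y=\min\{1,1-x+y\}$, and for $1\le i\le n$ put $F_{i/n}=\{x\in \mathbf{ŁV}_{n+1}: x\ge i/n\}$. Write $\varphi\otimes\psi=\neg(\varphi\to\neg\psi)$, $\varphi\oplus\psi=\neg\varphi\to\psi$, $\varphi\vee\psi=(\varphi\to\psi)\to\psi$, $\varphi\wedge\psi=\neg((\neg\varphi\to\neg\psi)\to\neg\psi)$, $k\varphi=\varphi\oplus\dots\oplus\varphi$ and $\varphi^k=\varphi\otimes\dots\otimes\varphi$ ($k$ times). A matrix $\langle\mathbf A,F\rangle$ defines the logic in which $\Gamma\vdash\varphi$ iff every homomorphism from the formula algebra to $\mathbf A$ that sends all of $\Gamma$ into $F$ also sends $\varphi$ into $F$. Let $$\mathsf L^i_n=\langle \mathbf{ŁV}_{n+1},F_{i/n}\rangle,\qquad \bar{\mathsf L}^i_n=\langle \mathbf{ŁV}_{n+1}\times\mathbf{ŁV}_2,\;F_{i/n}\times\{1\}\rangle,\qquad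 \mathsf{CPL}=\langle\mathbf{ŁV}_2,\{1\}\rangle .$$ A logic $L_1$ is *strongly maximal* with respect to $L_2$ if ${\vdash_{L_1}}\subsetneq{\vdash_{L_2}}$ and, for every finitary rule $\varphi_1,\dots,\varphi_m/\psi$ (with $m\ge 0$) such that $\varphi_1,\dots,\varphi_m\vdash_{L_2}\psi$ but $\varphi_1,\dots,\varphi_m\nvdash_{L_1}\psi$, the least structural consequence relation that extends $\vdash_{L_1}$ and contains all substitution instances of the rule is $\vdash_{L_2}$. A Hilbert calculus is a set of finitary schematic rules (axiom schemas are rules without premises); it *axiomatizes* a logic $L$ if, for all $\Gamma,\varphi$, the formula $\varphi$ is derivable from $\Gamma$ in it iff $\Gamma\vdash_L\varphi$. The calculus $\mathsf H^n_n$ is the usual axiomatization of the $(n+1)$-valued Łukasiewicz logic: modus ponens $\varphi,\varphi\to\psi/\psi$, Łukasiewicz' axiom schemas $\varphi\to(\psi\to\varphi)$, $(\varphi\to\psi)\to((\psi\to\chi)\to(\varphi\to\chi))$, $((\varphi\to\psi)\to\psi)\to((\psi\to\varphi)\to\varphi)$, $(\neg\varphi\to\neg\psi)\to(\psi\to\varphi)$,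 and, each read as two implications, Grigolia's schemas $\varphi^n\leftrightarrow\varphi^{n+1}$ and $(p\,\varphi^{p-1})^{n+1}\leftrightarrow(n+1)\varphi^p$ for every integer $2\le p<n$ with $p\nmid n$. For $1\le m\le n$ let $\lambda_{m,n}$ be the term in one variable, given by $\lambda_{0,k}(\varphi)=\varphi\to\varphi$, $\lambda_{m+1,0}(\varphi)=\neg(\varphi\to\varphi)$, $\lambda_{m+1,k+1}(\varphi)=(\lambda_{m+1,k}(\varphi)\oplus\varphi)\otimes\lambda_{m,k}(\varphi)$, which represents $a\mapsto\max\{0,\min\{1,na-(m-1)\}\}$ on $[0,1]$. For $1\le i<n$ the calculus $\mathsf H^i_n$ consists of the rules obtained from those of $\mathsf H^n_n$ by replacing every premise and conclusion $\alpha$ by $\lambda_{n,n}(\alpha)$, together with the rules $\varphi/\lambda_{n,n}(\lambda_{i,n}(\varphi))$ and $\lambda_{n,n}(\lambda_{i,n}(\varphi))/\varphi$. **Theorem.** Let $q$ be a prime number and $0<j\le q$. Then: 1. $\bar{\mathsf L}^j_q$ is strongly maximal with respect to $\mathsf{CPL}$. 2. $\mathsf H^j_q$ axiomatizes $\mathsf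 L^j_q$, and $\mathsf H^j_q$ plus the rule $j(\varphi\wedge\neg\varphi)/(\psi\vee\neg\psi)^q$ axiomatizes $\bar{\mathsf L}^j_q$. The latter holds likewise for every Hilbert calculus that axiomatizes $\mathsf L^j_q$ in place of $\mathsf H^j_q$. 3. $\mathsf L^j_q$ is strongly maximal with respect to $\bar{\mathsf L}^j_q$. Consequently $\mathsf L^j_q$ is not strongly maximal with respect to $\mathsf{CPL}$. -/

import Mathlib

namespace LukLogic

/-! ### Formulas over the signature of negation and implication -/

/-- Propositional formulas over the signature with a unary `¬` and a binary `→`. -/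
inductive Formula : Type
  | var : ℕ → Formula
  | neg : Formula → Formula
  | imp : Formula → Formula → Formula

namespace Formula

/-- Strong conjunction `φ ⊗ ψ = ¬(φ → ¬ψ)`. -/
def otimes (φ ψ : Formula) : Formula := neg (imp φ (neg ψ))

/-- Strong disjunction `φ ⊕ ψ = ¬φ → ψ`. -/
def oplus (φ ψ : Formula) : Formula := imp (neg φ) ψ

/-- Lattice disjunction `φ ∨ ψ = (φ → ψ) → ψ`. -/
def or (φ ψ : Formula) : Formula := imp (imp φ ψ) ψ

/-- Lattice conjunction `φ ∧ ψ = ¬((¬φ → ¬ψ) → ¬ψ)`. -/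
def and (φ ψ : Formula) : Formula := neg (imp (imp (neg φ) (neg ψ)) (neg ψ))

/-- `n φ = φ ⊕ ⋯ ⊕ φ` (`n` times); the value at `n = 0` is the constant falsum. -/
def nmul : ℕ → Formula → Formula
  | 0, φ => neg (imp φ φ)
  | 1, φ => φ
  | n + 2, φ => oplus (nmul (n + 1) φ) φ

/-- `φ ^ n = φ ⊗ ⋯ ⊗ φ` (`n` times); the value at `n = 0` is the constant verum. -/
def npow : ℕ → Formula → Formula
  | 0, φ => imp φ φ
  | 1, φ => φ
  | n + 2, φ => otimes (npow (n + 1) φ) φ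

/-- The term `λ_{m,n}`. On `[0,1]` it is the function `a ↦ max 0 (min 1 (n a - (m - 1)))`,
i.e. `0` for `a ≤ (m-1)/n`, `1` for `a ≥ m/n` and linear in between
(see `eval_lam` below for its values on the finite chains). -/
def lam : ℕ → ℕ → Formula → Formula
  | 0, _, φ => imp φ φ
  | _ + 1, 0, φ => neg (imp φ φ)
  | m + 1, n + 1, φ => otimes (oplus (lam (m + 1) n φ) φ) (lam m n φ)

/-- Application of the substitution determined by `s : ℕ → Formula`. -/
def subst (s : ℕ → Formula) : Formula → Formula
  | var k => s k
  | neg φ => neg (subst s φ)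
  | imp φ ψ => imp (subst s φ) (subst s ψ)

end Formula

open Formula

/-! ### Algebras, matrices and the logics they define -/

/-- An algebra over the signature `{¬, →}`. -/
class Alg (A : Type) where
  neg : A → A
  imp : A → A → A

/-- The product of two algebras, with coordinatewise operations. -/
instance {A B : Type} [Alg A] [Alg B] : Alg (A × B) where
  neg x := (Alg.neg x.1, Alg.neg x.2)
  imp x y := (Alg.imp x.1 y.1, Alg.imp x.2 y.2)

/-- The homomorphism from the formula algebra to `A` that extends `v`. -/
def Formula.eval {A : Type} [Alg A] (v : ℕ → A) : Formula → A
  | var k => v k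
  | neg φ => Alg.neg (eval v φ)
  | imp φ ψ => Alg.imp (eval v φ) (eval v ψ)

/-- Relations between sets of formulas and formulas. -/
abbrev Relation := Set Formula → Formula → Prop

/-- The consequence relation of the logical matrix `⟨A, F⟩`. -/
def matrixLogic (A : Type) [Alg A] (F : Set A) : Relation :=
  fun Γ φ => ∀ v : ℕ → A, (∀ ψ ∈ Γ, eval v ψ ∈ F) → eval v φ ∈ F

/-- The domain `{0, 1/n, …, (n-1)/n, 1}` of the `(n+1)`-element chain, for `n ≥ 1`:
see `mem_chain_iff`. -/
def chain (n : ℕ) : Set ℚ := {x | 0 ≤ x ∧ x ≤ 1 ∧ ∃ k : ℤ, (n : ℚ) * x = k}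

theorem mem_chain_iff {n : ℕ} (hn : 0 < n) (x : ℚ) :
    x ∈ chain n ↔ ∃ k : ℕ, k ≤ n ∧ x = (k : ℚ) / n := by
  have hn' : (0 : ℚ) < n := by exact_mod_cast hn
  constructor
  · rintro ⟨h0, h1, k, hk⟩
    have hk0 : (0 : ℚ) ≤ (k : ℚ) := by rw [← hk]; positivity
    have hk1 : (k : ℚ) ≤ n := by rw [← hk]; nlinarith
    have hk0' : 0 ≤ k := by exact_mod_cast hk0
    lift k to ℕ using hk0'
    refine ⟨k, by exact_mod_cast hk1, ?_⟩
    rw [eq_div_iff hn'.ne', mul_comm, hk]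
    simp
  · rintro ⟨k, hk, rfl⟩
    have hk' : (k : ℚ) ≤ n := by exact_mod_cast hk
    refine ⟨by positivity, (div_le_one hn').2 hk', k, ?_⟩
    field_simp
    simp

/-- The `(n+1)`-valued Łukasiewicz algebra `ŁV_{n+1}`: `¬x = 1 - x` and
`x → y = min 1 (1 - x + y)`. -/
instance (n : ℕ) : Alg (chain n) where
  neg x := ⟨1 - x.1, by
    obtain ⟨h0, h1, k, hk⟩ := x.2
    refine ⟨by linarith, by linarith, n - k, ?_⟩
    push_cast; rw [← hk]; ring⟩
  imp x y := ⟨min 1 (1 - x.1 + y.1), by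
    obtain ⟨h0, h1, k, hk⟩ := x.2
    obtain ⟨g0, g1, l, hl⟩ := y.2
    refine ⟨le_min zero_le_one (by linarith), min_le_left _ _, ?_⟩
    rcases min_choice (1 : ℚ) (1 - x.1 + y.1) with h | h <;> rw [h]
    · exact ⟨n, by push_cast; ring⟩
    · exact ⟨n - k + l, by push_cast; rw [← hk, ← hl]; ring⟩⟩

/-- The order filter `F_{i/n} = {x ∈ ŁV_{n+1} : x ≥ i/n}`. -/
def orderFilter (n i : ℕ) : Set (chain n) := {x | (i : ℚ) / n ≤ x.1}

/-- The logic `L^i_n = ⟨ŁV_{n+1}, F_{i/n}⟩`. -/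
def L (n i : ℕ) : Relation := matrixLogic (chain n) (orderFilter n i)

/-- Classical propositional logic, given by the two-element algebra `ŁV_2` with `1`
designated. -/
def CPL : Relation := matrixLogic (chain 1) {x | x.1 = 1}

/-- The logic `L̄^i_n = ⟨ŁV_{n+1} × ŁV_2, F_{i/n} × {1}⟩`. -/
def Lbar (n i : ℕ) : Relation :=
  matrixLogic (chain n × chain 1) (orderFilter n i ×ˢ {x | x.1 = 1})

/-- For `1 ≤ n`, the term `λ_{i,n}` is the characteristic function of `F_{i/n}` on `ŁV_{n+1}`;
more generally its value at `a` is `max 0 (min 1 (m a - (i - 1)))` for `λ_{i,m}`. -/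
theorem eval_lam {n : ℕ} (v : ℕ → chain n) (φ : Formula) (i m : ℕ) :
    (eval v (lam i m φ)).1 = max 0 (min 1 ((m : ℚ) * (eval v φ).1 - ((i : ℚ) - 1))) := by
  obtain ⟨h0, h1, -⟩ := (eval v φ).2
  have key : ∀ A : ℚ,
      1 - min 1 (1 - min 1 (1 - (1 - max 0 (min 1 A)) + (eval v φ).1) +
        (1 - max 0 (min 1 (A + 1)))) = max 0 (min 1 (A + (eval v φ).1)) := by
    intro A
    simp only [min_def, max_def]
    split_ifs <;> linarith
  induction m generalizing i with
  | zero =>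
    cases i with
    | zero => simp [lam, eval, Alg.imp]
    | succ i =>
      have hi : (0 : ℚ) ≤ i := Nat.cast_nonneg i
      simp only [lam, eval, Alg.imp, Alg.neg]
      push_cast
      rw [min_eq_left (by linarith), min_eq_right (by linarith), max_eq_left (by linarith)]
      ring
  | succ m ih =>
    cases i with
    | zero =>
      have hm : (0 : ℚ) ≤ ((m + 1 : ℕ) : ℚ) * (eval v φ).1 := by positivity
      simp only [lam, eval, Alg.imp]
      push_cast at hm ⊢
      rw [min_eq_left (by linarith), min_eq_left (by linarith), max_eq_right zero_le_one]
    | succ i =>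
      have e1 := ih (i + 1)
      have e2 := ih i
      simp only [lam, otimes, oplus, eval, Alg.imp, Alg.neg] at e1 e2 ⊢
      rw [e1, e2]
      have := key ((m : ℚ) * (eval v φ).1 - i)
      push_cast
      convert this using 3 <;> ring_nf

/-! ### Rules, extensions by a rule, strong maximality -/

/-- A finitary rule `φ₁, …, φₙ / ψ`; the list of premises may be empty. -/
structure Rule where
  prems : List Formula
  concl : Formula

/-- Structural Tarskian consequence relations. -/
structure IsLogic (C : Relation) : Prop where
  refl : ∀ (Γ : Set Formula) (φ : Formula), φ ∈ Γ → C Γ φ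
  mono : ∀ (Γ Δ : Set Formula) (φ : Formula), Γ ⊆ Δ → C Γ φ → C Δ φ
  cut : ∀ (Γ Δ : Set Formula) (φ : Formula), (∀ ψ ∈ Δ, C Γ ψ) → C Δ φ → C Γ φ
  structural : ∀ (s : ℕ → Formula) (Γ : Set Formula) (φ : Formula),
    C Γ φ → C (subst s '' Γ) (subst s φ)

/-- `φ₁, …, φₙ ⊢_C ψ`. -/
def Rule.ValidIn (r : Rule) (C : Relation) : Prop := C {φ | φ ∈ r.prems} r.concl

/-- The logic obtained from `C` by adding `r` as a structural rule: the least structural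
consequence relation that extends `C` and contains every substitution instance of `r`. -/
def addRule (C : Relation) (r : Rule) : Relation :=
  fun Γ φ => ∀ D : Relation, IsLogic D → (∀ Δ ψ, C Δ ψ → D Δ ψ) →
    (∀ s : ℕ → Formula, D {χ | ∃ φ ∈ r.prems, χ = subst s φ} (subst s r.concl)) → D Γ φ

/-- `C₁` is a proper sublogic of `C₂`. -/
def ProperSublogic (C₁ C₂ : Relation) : Prop :=
  (∀ Γ φ, C₁ Γ φ → C₂ Γ φ) ∧ ∃ Γ φ, C₂ Γ φ ∧ ¬ C₁ Γ φ

/-- `C₁` is strongly maximal with respect to `C₂`. -/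
def StronglyMaximal (C₁ C₂ : Relation) : Prop :=
  ProperSublogic C₁ C₂ ∧
    ∀ r : Rule, r.ValidIn C₂ → ¬ r.ValidIn C₁ → ∀ Γ φ, addRule C₁ r Γ φ ↔ C₂ Γ φ

/-! ### Hilbert calculi -/

/-- Derivability from hypotheses `Γ` in the Hilbert calculus with the schematic rules `R`
(an axiom schema is a rule without premises). -/
inductive Derives (R : Set Rule) (Γ : Set Formula) : Formula → Prop
  | hyp (φ : Formula) : φ ∈ Γ → Derives R Γ φ
  | app (r : Rule) (s : ℕ → Formula) : r ∈ R → (∀ φ ∈ r.prems, Derives R Γ (subst s φ)) →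
      Derives R Γ (subst s r.concl)

/-- The calculus `R` axiomatizes `C`: it is sound and complete for `C`. -/
def Axiomatizes (R : Set Rule) (C : Relation) : Prop :=
  ∀ (Γ : Set Formula) (φ : Formula), Derives R Γ φ ↔ C Γ φ

/-- Łukasiewicz' calculus for the infinite-valued logic: four axiom schemas and modus ponens. -/
def lukInftyRules : Set Rule :=
  {⟨[], imp (var 0) (imp (var 1) (var 0))⟩,
   ⟨[], imp (imp (var 0) (var 1)) (imp (imp (var 1) (var 2)) (imp (var 0) (var 2)))⟩,
   ⟨[], imp (imp (imp (var 0) (var 1)) (var 1)) (imp (imp (var 1) (var 0)) (var 0))⟩,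
   ⟨[], imp (imp (neg (var 0)) (neg (var 1))) (imp (var 1) (var 0))⟩,
   ⟨[var 0, imp (var 0) (var 1)], var 1⟩}

/-- The two axiom schemas that express `φ ↔ ψ`. -/
def iffAxioms (φ ψ : Formula) : Set Rule := {⟨[], imp φ ψ⟩, ⟨[], imp ψ φ⟩}

/-- The usual (Grigolia) axiomatization of the `(n+1)`-valued Łukasiewicz logic: the
infinite-valued calculus with the axioms `φ^n ↔ φ^(n+1)` and
`(p φ^(p-1))^(n+1) ↔ (n+1) φ^p` for all `2 ≤ p < n` that do not divide `n`. -/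
def lukRules (n : ℕ) : Set Rule :=
  lukInftyRules ∪ iffAxioms (npow n (var 0)) (npow (n + 1) (var 0)) ∪
    ⋃ p ∈ {p : ℕ | 2 ≤ p ∧ p < n ∧ ¬ p ∣ n},
      iffAxioms (npow (n + 1) (nmul p (npow (p - 1) (var 0)))) (nmul (n + 1) (npow p (var 0)))

/-- The calculus `H^i_n`. For `i = n` it is the calculus above; for `i ≠ n` it is its translation
along `τ(φ) = λ_{i,n}(φ)` and `σ(φ) = λ_{n,n}(φ)`: the rules are the `σ`-translations of
the rules of the calculus above, together with `φ / σ(τ(φ))` and `σ(τ(φ)) / φ`. -/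
def H (n i : ℕ) : Set Rule :=
  if i = n then lukRules n
  else (fun r : Rule => (⟨r.prems.map (lam n n), lam n n r.concl⟩ : Rule)) '' lukRules n ∪
    {⟨[var 0], lam n n (lam i n (var 0))⟩, ⟨[lam n n (lam i n (var 0))], var 0⟩}

/-- The rule `j(φ ∧ ¬φ) / (ψ ∨ ¬ψ)^q`. -/
def explosionRule (q j : ℕ) : Rule :=
  ⟨[nmul j (and (var 0) (neg (var 0)))], npow q (or (var 1) (neg (var 1)))⟩

end LukLogic

/-!
Throughout, a set of premises is *classically satisfiable* if it has a Boolean-valued model. The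
inclusion of `ŁV_2` in `ŁV_{n+1}` turns `CPL` and `Lbar` into statements about valuations in one
chain: `CPL` is consequence over Boolean valuations (`CPL_iff`), and `Lbar` is `L` on classically
satisfiable sets of premises and trivial on the others (`Lbar_iff`).

Completeness of the calculus for `L n n` is algebraic. A formula that is not derivable is omitted
by a theory whose Lindenbaum algebra is a linearly ordered Wajsberg algebra
(`exists_prime_theory`). As `x ^ n = x ^ (n + 1)` holds there, this algebra consists of the powers
of a coatom, so it is a chain `ŁV_{m+1}` with `m ≤ n` (`WajsbergAlgebra.exists_isHom_chain`), and
the remaining axiom schemas force `m ∣ n`. For the other filters the terms `λ_{i,n}` translate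
between the logics (`axiomatizes_H`).

The premise `j (φ ∧ ¬φ)` of the explosion rule holds where `φ` is not Boolean, its conclusion
`(ψ ∨ ¬ψ)^q` where `ψ` is. If `Γ` is classically unsatisfiable, compactness gives one formula `θ`
that is non-Boolean in all models of `Γ` (`exists_forced_not_isBool`); so the explosion rule makes
every formula Boolean, and then `Γ` is contradictory. Hence every logic that contains `L` and the
rule contains `Lbar` (`IsLogic.Lbar_le`), whatever calculus is used for `L`.

Strong maximality rests on a definability property of `ŁV_{q+1}` for prime `q`: each non-Boolean
element generates the chain, so there are substitutions by formulas in `φ` that act as a given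
valuation `v` where `φ` is not Boolean and as a given Boolean valuation `w` where it is
(`exists_glue`). Applied to a rule that fails in `Lbar` or in `L`, such a substitution derives
from the rule `(χ ∨ ¬χ)^q` for every `χ`, respectively the explosion rule.
-/

namespace LukLogic

open Formula

/-! ### Evaluation in the chains -/

/-- Homomorphisms of `{¬, →}`-algebras. -/
structure IsHom {A B : Type} [Alg A] [Alg B] (f : A → B) : Prop where
  map_neg : ∀ x, f (Alg.neg x) = Alg.neg (f x)
  map_imp : ∀ x y, f (Alg.imp x y) = Alg.imp (f x) (f y)

theorem IsHom.eval {A B : Type} [Alg A] [Alg B] {f : A → B} (hf : IsHom f) (v : ℕ → A)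
    (φ : Formula) : f (eval v φ) = Formula.eval (fun k => f (v k)) φ := by
  induction φ with
  | var k => rfl
  | neg φ ih => simp only [Formula.eval, hf.map_neg, ih]
  | imp φ ψ ih₁ ih₂ => simp only [Formula.eval, hf.map_imp, ih₁, ih₂]

theorem eval_subst {A : Type} [Alg A] (v : ℕ → A) (s : ℕ → Formula) (φ : Formula) :
    eval v (subst s φ) = eval (fun k => eval v (s k)) φ := by
  induction φ with
  | var k => rfl
  | neg φ ih => simp only [Formula.eval, subst, ih]
  | imp φ ψ ih₁ ih₂ => simp only [Formula.eval, subst, ih₁, ih₂]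

theorem eval_fst {A B : Type} [Alg A] [Alg B] (v : ℕ → A × B) (φ : Formula) :
    (eval v φ).1 = eval (fun k => (v k).1) φ :=
  IsHom.eval (f := Prod.fst) ⟨fun _ => rfl, fun _ _ => rfl⟩ v φ

theorem eval_snd {A B : Type} [Alg A] [Alg B] (v : ℕ → A × B) (φ : Formula) :
    (eval v φ).2 = eval (fun k => (v k).2) φ :=
  IsHom.eval (f := Prod.snd) ⟨fun _ => rfl, fun _ _ => rfl⟩ v φ

section Chain

variable {n : ℕ} (v : ℕ → chain n) (φ ψ : Formula)

theorem eval_var (k : ℕ) : eval v (var k) = v k := rfl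

theorem eval_neg : (eval v (neg φ)).1 = 1 - (eval v φ).1 := rfl

theorem eval_imp : (eval v (imp φ ψ)).1 = min 1 (1 - (eval v φ).1 + (eval v ψ).1) := rfl

theorem chain_nonneg (x : chain n) : 0 ≤ x.1 := x.2.1

theorem chain_le_one (x : chain n) : x.1 ≤ 1 := x.2.2.1

theorem eval_otimes :
    (eval v (otimes φ ψ)).1 = max 0 ((eval v φ).1 + (eval v ψ).1 - 1) := by
  simp only [otimes, eval_neg, eval_imp, min_def, max_def]
  split_ifs <;> linarith

theorem eval_oplus : (eval v (oplus φ ψ)).1 = min 1 ((eval v φ).1 + (eval v ψ).1) := by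
  simp only [oplus, eval_neg, eval_imp]
  congr 1; ring

theorem eval_or : (eval v (Formula.or φ ψ)).1 = max (eval v φ).1 (eval v ψ).1 := by
  have h := chain_le_one (eval v φ)
  have h' := chain_le_one (eval v ψ)
  simp only [Formula.or, eval_imp, min_def, max_def]
  split_ifs <;> linarith

theorem eval_and : (eval v (Formula.and φ ψ)).1 = min (eval v φ).1 (eval v ψ).1 := by
  have h := chain_nonneg (eval v φ)
  have h' := chain_nonneg (eval v ψ)
  simp only [Formula.and, eval_imp, eval_neg, min_def]
  split_ifs <;> linarith

theorem eval_nmul (k : ℕ) : (eval v (nmul k φ)).1 = min 1 (k * (eval v φ).1) := by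
  have h := chain_nonneg (eval v φ)
  have h' := chain_le_one (eval v φ)
  induction k using Nat.twoStepInduction with
  | zero => simp [nmul, eval_neg, eval_imp]
  | one => simp [nmul, h']
  | more k _ ih =>
    rw [nmul, eval_oplus, ih]
    push_cast
    simp only [min_def]
    split_ifs <;> linarith

theorem eval_npow (k : ℕ) : (eval v (npow k φ)).1 = max 0 (1 - k * (1 - (eval v φ).1)) := by
  have h := chain_nonneg (eval v φ)
  have h' := chain_le_one (eval v φ)
  induction k using Nat.twoStepInduction with
  | zero => simp [npow, eval_imp]
  | one => simp [npow, h]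
  | more k _ ih =>
    rw [npow, eval_otimes, ih]
    push_cast
    simp only [max_def]
    split_ifs <;> linarith

end Chain

/-- The Boolean elements `0` and `1` of a chain. -/
def IsBool {n : ℕ} (x : chain n) : Prop := x.1 = 0 ∨ x.1 = 1

/-- The inclusion of `ŁV_{m+1}` in `ŁV_{n+1}` when `m` divides `n`. -/
def chainIncl {m n : ℕ} (h : m ∣ n) (x : chain m) : chain n :=
  ⟨x.1, x.2.1, x.2.2.1, by
    obtain ⟨c, rfl⟩ := h
    obtain ⟨k, hk⟩ := x.2.2.2
    exact ⟨c * k, by push_cast; rw [← hk]; ring⟩⟩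

theorem isHom_chainIncl {m n : ℕ} (h : m ∣ n) : IsHom (chainIncl h) :=
  ⟨fun _ => rfl, fun _ _ => rfl⟩

theorem isBool_chain_one (x : chain 1) : IsBool x := by
  obtain ⟨k, hk, h⟩ := (mem_chain_iff one_pos x.1).1 x.2
  interval_cases k
  · left; simpa using h
  · right; simpa using h

/-- A Boolean element of a chain, as an element of `ŁV_2`. -/
def toChainOne {n : ℕ} (x : chain n) (hx : IsBool x) : chain 1 :=
  ⟨x.1, x.2.1, x.2.2.1, by
    rcases hx with h | h
    · exact ⟨0, by simp [h]⟩
    · exact ⟨1, by simp [h]⟩⟩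

theorem IsBool.mem_orderFilter {n i : ℕ} (hi : 0 < i) (hin : i ≤ n) {x : chain n}
    (hx : IsBool x) : x ∈ orderFilter n i ↔ x.1 = 1 := by
  have hn : (0 : ℚ) < n := by exact_mod_cast hi.trans_le hin
  have h1 : (i : ℚ) / n ≤ 1 := (div_le_one hn).2 (by exact_mod_cast hin)
  have h0 : 0 < (i : ℚ) / n := div_pos (by exact_mod_cast hi) hn
  rcases hx with h | h <;> simp only [orderFilter, Set.mem_ofPred_eq, h]
  · exact iff_of_false (not_le.2 h0) zero_ne_one
  · exact iff_of_true h1 trivial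

theorem mem_orderFilter_self {n : ℕ} (hn : 0 < n) (x : chain n) :
    x ∈ orderFilter n n ↔ x.1 = 1 := by
  have hn' : (n : ℚ) ≠ 0 := by exact_mod_cast hn.ne'
  simp only [orderFilter, Set.mem_ofPred_eq, div_self hn']
  exact ⟨fun h => le_antisymm (chain_le_one x) h, fun h => h.ge⟩

theorem exists_eq_div_of_not_isBool {n : ℕ} (hn : 0 < n) {x : chain n} (hx : ¬ IsBool x) :
    ∃ k : ℕ, 0 < k ∧ k < n ∧ x.1 = (k : ℚ) / n := by
  obtain ⟨k, hk, h⟩ := (mem_chain_iff hn x.1).1 x.2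
  have hn' : (n : ℚ) ≠ 0 := by exact_mod_cast hn.ne'
  refine ⟨k, Nat.pos_of_ne_zero ?_, lt_of_le_of_ne hk ?_, h⟩
  · rintro rfl
    exact hx (Or.inl (by simpa using h))
  · rintro rfl
    exact hx (Or.inr (by rw [h, div_self hn']))

/-! ### Matrix logics and derivability are structural consequence relations -/

theorem isLogic_matrixLogic (A : Type) [Alg A] (F : Set A) : IsLogic (matrixLogic A F) where
  refl _ φ h v hv := hv φ h
  mono _ _ _ h hC v hv := hC v fun ψ hψ => hv ψ (h hψ)
  cut _ _ _ h hC v hv := hC v fun ψ hψ => h ψ hψ v hv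
  structural s Γ φ h v hv := by
    rw [eval_subst]
    refine h _ fun ψ hψ => ?_
    rw [← eval_subst]
    exact hv _ ⟨ψ, hψ, rfl⟩

theorem subst_var (φ : Formula) : subst var φ = φ := by
  induction φ with
  | var k => rfl
  | neg φ ih => simp only [subst, ih]
  | imp φ ψ ih₁ ih₂ => simp only [subst, ih₁, ih₂]

theorem subst_subst (s t : ℕ → Formula) (φ : Formula) :
    subst s (subst t φ) = subst (fun k => subst s (t k)) φ := by
  induction φ with
  | var k => rfl
  | neg φ ih => simp only [subst, ih]
  | imp φ ψ ih₁ ih₂ => simp only [subst, ih₁, ih₂]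

theorem Derives.cut {R : Set Rule} {Γ Δ : Set Formula} {φ : Formula}
    (h : ∀ ψ ∈ Δ, Derives R Γ ψ) (hφ : Derives R Δ φ) : Derives R Γ φ := by
  induction hφ with
  | hyp φ hφ => exact h φ hφ
  | app r s hr _ ih => exact .app r s hr ih

theorem Derives.mono_rules {R S : Set Rule} (hRS : R ⊆ S) {Γ : Set Formula} {φ : Formula}
    (hφ : Derives R Γ φ) : Derives S Γ φ := by
  induction hφ with
  | hyp φ hφ => exact .hyp φ hφ
  | app r s hr _ ih => exact .app r s (hRS hr) ih

theorem isLogic_derives (R : Set Rule) : IsLogic (Derives R) where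
  refl _ φ h := .hyp φ h
  mono _ _ _ h hφ := hφ.cut fun ψ hψ => .hyp ψ (h hψ)
  cut _ _ _ h hφ := hφ.cut h
  structural s Γ φ h := by
    induction h with
    | hyp φ hφ => exact .hyp _ ⟨φ, hφ, rfl⟩
    | app r t hr _ ih =>
      rw [subst_subst]
      refine .app r _ hr fun φ hφ => ?_
      rw [← subst_subst]
      exact ih φ hφ

theorem IsLogic.rule_instance {C : Relation} (hC : IsLogic C) {r : Rule} (hr : r.ValidIn C)
    (s : ℕ → Formula) : C {χ | ∃ φ ∈ r.prems, χ = subst s φ} (subst s r.concl) := by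
  refine hC.mono _ _ _ ?_ (hC.structural s _ _ hr)
  rintro _ ⟨φ, hφ, rfl⟩
  exact ⟨φ, hφ, rfl⟩

theorem IsLogic.of_derives {C : Relation} (hC : IsLogic C) {R : Set Rule}
    (hR : ∀ r ∈ R, r.ValidIn C) {Γ : Set Formula} {φ : Formula} (h : Derives R Γ φ) :
    C Γ φ := by
  induction h with
  | hyp φ hφ => exact hC.refl Γ φ hφ
  | app r s hr _ ih =>
    refine hC.cut _ _ _ ?_ (hC.rule_instance (hR r hr) s)
    rintro _ ⟨φ, hφ, rfl⟩
    exact ih φ hφ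

theorem derives_of_mem {R : Set Rule} {r : Rule} (hr : r ∈ R) : r.ValidIn (Derives R) := by
  have := Derives.app (Γ := {φ | φ ∈ r.prems}) r var hr fun φ hφ => by
    rw [subst_var]; exact .hyp φ hφ
  rwa [subst_var] at this

/-- Strong maximality, with the least extension by a rule unfolded: one inclusion is automatic,
as `C₂` itself is a logic that contains `C₁` and the rule. -/
theorem StronglyMaximal.intro {C₁ C₂ : Relation} (hC₂ : IsLogic C₂) (h : ProperSublogic C₁ C₂)
    (hmax : ∀ r : Rule, r.ValidIn C₂ → ¬ r.ValidIn C₁ → ∀ D : Relation, IsLogic D →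
      (∀ Γ φ, C₁ Γ φ → D Γ φ) →
      (∀ s, D {χ | ∃ φ ∈ r.prems, χ = subst s φ} (subst s r.concl)) →
      ∀ Γ φ, C₂ Γ φ → D Γ φ) : StronglyMaximal C₁ C₂ :=
  ⟨h, fun r h₂ h₁ Γ φ => ⟨fun hr => hr C₂ hC₂ h.1 (hC₂.rule_instance h₂),
    fun hφ D hD hle hr => hmax r h₂ h₁ D hD hle hr Γ φ hφ⟩⟩

/-! ### The logics `L`, `Lbar` and `CPL` in terms of valuations in one chain -/

/-- `w` is a Boolean-valued model of `Γ` in the matrix `⟨ŁV_{n+1}, F_{i/n}⟩`. -/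
def BoolModel (n i : ℕ) (Γ : Set Formula) (w : ℕ → chain n) : Prop :=
  (∀ k, IsBool (w k)) ∧ ∀ ψ ∈ Γ, eval w ψ ∈ orderFilter n i

theorem isBool_eval {n : ℕ} {w : ℕ → chain n} (hw : ∀ k, IsBool (w k)) (φ : Formula) :
    IsBool (eval w φ) := by
  have h := (isHom_chainIncl (one_dvd n)).eval (fun k => toChainOne (w k) (hw k)) φ
  have h' : (fun k => chainIncl (one_dvd n) (toChainOne (w k) (hw k))) = w := rfl
  rw [h'] at h
  rw [← h]
  exact isBool_chain_one (eval (fun k => toChainOne (w k) (hw k)) φ)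

section Logics

variable {n i : ℕ} (hi : 0 < i) (hin : i ≤ n)
include hi hin

theorem eval_chainOne_mem (w : ℕ → chain 1) (φ : Formula) :
    eval w φ ∈ {x : chain 1 | x.1 = 1} ↔
      eval (fun k => chainIncl (one_dvd n) (w k)) φ ∈ orderFilter n i := by
  have hw : ∀ k, IsBool (chainIncl (one_dvd n) (w k)) := fun k => isBool_chain_one (w k)
  rw [(isBool_eval hw φ).mem_orderFilter hi hin, ← (isHom_chainIncl (one_dvd n)).eval]
  rfl

theorem CPL_iff (Γ : Set Formula) (φ : Formula) :
    CPL Γ φ ↔ ∀ w : ℕ → chain n, BoolModel n i Γ w → eval w φ ∈ orderFilter n i := by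
  constructor
  · rintro h w ⟨hw, hΓ⟩
    refine (eval_chainOne_mem hi hin (fun k => toChainOne (w k) (hw k)) φ).1 (h _ fun ψ hψ => ?_)
    exact (eval_chainOne_mem hi hin _ ψ).2 (hΓ ψ hψ)
  · intro h w hw
    refine (eval_chainOne_mem hi hin w φ).2 (h _ ⟨fun k => isBool_chain_one (w k), fun ψ hψ => ?_⟩)
    exact (eval_chainOne_mem hi hin w ψ).1 (hw ψ hψ)

/-- `L̄^i_n` is `L^i_n` on the classically satisfiable sets of premises and trivial on the
others. -/
theorem Lbar_iff (Γ : Set Formula) (φ : Formula) :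
    Lbar n i Γ φ ↔ ((∃ w, BoolModel n i Γ w) → L n i Γ φ) := by
  constructor
  · rintro h ⟨w, hw, hwΓ⟩ v hv
    have := h (fun k => (v k, toChainOne (w k) (hw k))) fun ψ hψ => by
      rw [Set.mem_prod, eval_fst, eval_snd]
      exact ⟨hv ψ hψ, (eval_chainOne_mem hi hin _ ψ).2 (hwΓ ψ hψ)⟩
    rw [Set.mem_prod, eval_fst] at this
    exact this.1
  · intro h v hv
    have hv' := fun ψ hψ => Set.mem_prod.1 (hv ψ hψ)
    simp only [eval_fst, eval_snd] at hv'
    have hw := fun ψ hψ => (eval_chainOne_mem hi hin _ ψ).1 (hv' ψ hψ).2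
    have hL := h ⟨_, fun k => isBool_chain_one (v k).2, hw⟩
    rw [Set.mem_prod, eval_fst, eval_snd]
    exact ⟨hL _ fun ψ hψ => (hv' ψ hψ).1, (eval_chainOne_mem hi hin _ φ).2 (hL _ hw)⟩

theorem L_le_Lbar (Γ : Set Formula) (φ : Formula) (h : L n i Γ φ) : Lbar n i Γ φ :=
  (Lbar_iff hi hin Γ φ).2 fun _ => h

theorem Lbar_le_CPL (Γ : Set Formula) (φ : Formula) (h : Lbar n i Γ φ) : CPL Γ φ :=
  (CPL_iff hi hin Γ φ).2 fun w hw => (Lbar_iff hi hin Γ φ).1 h ⟨w, hw⟩ w hw.2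

end Logics

/-! ### Wajsberg algebras -/

/-- Wajsberg algebras: the algebras of the infinite-valued Łukasiewicz logic, in the signature
`{¬, →, 1}`. They are term equivalent to MV-algebras. -/
class WajsbergAlgebra (A : Type) extends Alg A, One A where
  one_imp : ∀ x : A, imp 1 x = x
  imp_imp_imp : ∀ x y z : A, imp (imp x y) (imp (imp y z) (imp x z)) = 1
  imp_imp_comm : ∀ x y : A, imp (imp x y) y = imp (imp y x) x
  neg_imp_neg_imp : ∀ x y : A, imp (imp (neg x) (neg y)) (imp y x) = 1

local infixr:60 " ⇒ " => Alg.imp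
local prefix:max "∼" => Alg.neg

namespace WajsbergAlgebra

variable {A : Type} [WajsbergAlgebra A]

theorem imp_self (x : A) : x ⇒ x = 1 := by
  simpa only [one_imp] using imp_imp_imp (1 : A) 1 x

theorem imp_one (x : A) : x ⇒ 1 = 1 := by
  have h := imp_imp_comm x 1
  rw [one_imp, imp_self] at h
  have h' := imp_imp_imp 1 x (1 : A)
  rwa [one_imp, one_imp, h] at h'

/-- The natural order: `x ≤ y` iff `x → y = 1`. -/
instance : PartialOrder A where
  le x y := x ⇒ y = 1
  le_refl := imp_self
  le_trans x y z h₁ h₂ := by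
    have h := imp_imp_imp x y z
    rwa [h₁, h₂, one_imp, one_imp] at h
  le_antisymm x y h₁ h₂ := by
    have h := imp_imp_comm x y
    rw [h₁, h₂, one_imp, one_imp] at h
    exact h.symm

theorem le_def {x y : A} : x ≤ y ↔ x ⇒ y = 1 := Iff.rfl

theorem le_one' (x : A) : x ≤ 1 := imp_one x

theorem one_le_iff {x : A} : 1 ≤ x ↔ x = 1 := by rw [le_def, one_imp]

theorem le_imp (x y : A) : x ≤ y ⇒ x := by
  have h := imp_imp_imp y 1 x
  rwa [imp_one, one_imp, one_imp] at h

theorem le_imp_imp (x y : A) : x ≤ (x ⇒ y) ⇒ y := by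
  rw [imp_imp_comm]
  exact le_imp _ _

theorem imp_anti {x y : A} (h : x ≤ y) (z : A) : y ⇒ z ≤ x ⇒ z := by
  have h' := imp_imp_imp x y z
  rwa [le_def.1 h, one_imp] at h'

theorem le_imp_swap {x y z : A} (h : x ≤ y ⇒ z) : y ≤ x ⇒ z :=
  (le_imp_imp y z).trans (imp_anti h z)

theorem imp_le_imp_imp (x y z : A) : y ⇒ z ≤ (x ⇒ y) ⇒ (x ⇒ z) :=
  le_imp_swap (imp_imp_imp x y z)

theorem imp_left_comm (x y z : A) : x ⇒ y ⇒ z = y ⇒ x ⇒ z := by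
  have key : ∀ x y z : A, x ⇒ y ⇒ z ≤ y ⇒ x ⇒ z := fun x y z =>
    le_imp_swap ((le_imp_imp y z).trans (imp_le_imp_imp x _ z))
  exact le_antisymm (key x y z) (key y x z)

theorem neg_neg' (x : A) : ∼∼x = x := by
  have key : ∀ x : A, ∼∼x ≤ x := fun x => by
    have h := ((le_imp (∼∼x) (∼∼(1 : A))).trans (neg_imp_neg_imp (∼(1 : A)) (∼x))).trans
      (neg_imp_neg_imp x (1 : A))
    rwa [one_imp] at h
  refine le_antisymm (key x) ?_
  have h := neg_imp_neg_imp (∼∼x) x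
  rwa [le_def.1 (key (∼x)), one_imp] at h

theorem imp_eq_neg_imp_neg (x y : A) : x ⇒ y = ∼y ⇒ ∼x := by
  refine le_antisymm ?_ (neg_imp_neg_imp y x)
  have h := neg_imp_neg_imp (∼x) (∼y)
  rwa [neg_neg', neg_neg'] at h

theorem neg_eq (x : A) : ∼x = x ⇒ ∼1 := by
  rw [imp_eq_neg_imp_neg, neg_neg', one_imp]

theorem imp_neg_comm (x y : A) : x ⇒ ∼y = y ⇒ ∼x := by
  rw [imp_eq_neg_imp_neg, neg_neg']

theorem neg_one_le (x : A) : ∼1 ≤ x := by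
  rw [le_def, imp_eq_neg_imp_neg, neg_neg', imp_one]

/-- The strong conjunction `x ⊗ y = ¬(x → ¬y)` is the multiplication, so that `x ^ k` is the
`k`-fold strong conjunction. -/
instance : CommMonoid A where
  mul x y := ∼(x ⇒ ∼y)
  mul_comm x y := congrArg Alg.neg (imp_neg_comm x y)
  mul_assoc x y z := by
    change ∼(∼(x ⇒ ∼y) ⇒ ∼z) = ∼(x ⇒ ∼∼(y ⇒ ∼z))
    rw [imp_neg_comm, neg_neg', neg_neg', imp_left_comm, imp_neg_comm z y]
  one_mul x := by
    change ∼(1 ⇒ ∼x) = x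
    rw [one_imp, neg_neg']
  mul_one x := by
    change ∼(x ⇒ ∼1) = x
    rw [← neg_eq, neg_neg']

theorem mul_def (x y : A) : x * y = ∼(x ⇒ ∼y) := rfl

theorem mul_imp (x y z : A) : x * y ⇒ z = x ⇒ y ⇒ z := by
  rw [mul_def, imp_eq_neg_imp_neg, neg_neg', imp_left_comm, ← imp_eq_neg_imp_neg]

theorem mul_le_iff {x y z : A} : x * y ≤ z ↔ x ≤ y ⇒ z := by
  rw [le_def, le_def, mul_imp]

instance : IsOrderedMonoid A where
  mul_le_mul_left _ _ h _ := mul_le_iff.2 (h.trans (mul_le_iff.1 le_rfl))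

theorem mul_le_left (x y : A) : x * y ≤ x := mul_le_iff.2 (le_imp x y)

theorem mul_imp_self {x y : A} (h : y ≤ x) : x * (x ⇒ y) = y := by
  rw [mul_def, imp_neg_comm, imp_eq_neg_imp_neg x y, imp_imp_comm, ← imp_eq_neg_imp_neg,
    le_def.1 h, one_imp, neg_neg']

theorem imp_mul (x y : A) : x ⇒ x * y = (y ⇒ ∼x) ⇒ ∼x := by
  rw [mul_def, imp_neg_comm, imp_neg_comm x y]

/-- `x ∨ y = (x → y) → y` is the join. -/
theorem join_le_iff {x y z : A} : (x ⇒ y) ⇒ y ≤ z ↔ x ≤ z ∧ y ≤ z := by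
  constructor
  · exact fun h => ⟨(le_imp_imp x y).trans h, (le_imp y _).trans h⟩
  · rintro ⟨hx, hy⟩
    calc (x ⇒ y) ⇒ y ≤ (z ⇒ y) ⇒ y := imp_anti (imp_anti hx y) y
      _ = (y ⇒ z) ⇒ z := imp_imp_comm z y
      _ = z := by rw [le_def.1 hy, one_imp]

theorem join_mul_le_iff {x y z w : A} :
    ((x ⇒ y) ⇒ y) * w ≤ z ↔ x * w ≤ z ∧ y * w ≤ z := by
  rw [mul_le_iff, join_le_iff, mul_le_iff, mul_le_iff]

/-- Prelinearity: `(x → y) ∨ (y → x) = 1`. -/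
theorem join_imp_imp (x y : A) : ((x ⇒ y) ⇒ (y ⇒ x)) ⇒ (y ⇒ x) = 1 := by
  rw [← le_def, ← mul_le_iff]
  set t := (x ⇒ y) ⇒ (y ⇒ x) with ht
  have h : t * (x ⇒ y) * y ≤ x := by
    rw [mul_le_iff, mul_le_iff]
  -- `y = (x → y) ⊗ (x ∨ y)`, and multiplication distributes over the join.
  have hy : t * y = ((x ⇒ y) ⇒ y) * (t * (x ⇒ y)) := by
    nth_rewrite 1 [← mul_imp_self (le_imp y x)]
    rw [← mul_assoc, mul_comm]
  rw [hy, join_mul_le_iff]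
  exact ⟨mul_le_left _ _, by rw [mul_comm]; exact h⟩

/-- If `x ∨ z = 1` and `(x → y) ∨ z = 1` then `y ∨ z = 1`. -/
theorem join_mp {x y z : A} (h₁ : (x ⇒ z) ⇒ z = 1) (h₂ : ((x ⇒ y) ⇒ z) ⇒ z = 1) :
    (y ⇒ z) ⇒ z = 1 := by
  rw [← one_le_iff]
  have hy := le_imp_imp y z
  have hz := le_imp z (y ⇒ z)
  have h : ((x ⇒ z) ⇒ z) * (((x ⇒ y) ⇒ z) ⇒ z) ≤ (y ⇒ z) ⇒ z := by
    rw [join_mul_le_iff]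
    refine ⟨?_, (mul_le_left _ _).trans hz⟩
    rw [mul_comm, join_mul_le_iff]
    exact ⟨(mul_le_iff.2 le_rfl).trans hy, (mul_le_left _ _).trans hz⟩
  rwa [h₁, h₂, one_mul] at h

theorem join_self (x : A) : (x ⇒ x) ⇒ x = x := by rw [imp_self, one_imp]

theorem eval_npow {v : ℕ → A} (φ : Formula) (k : ℕ) : eval v (npow k φ) = eval v φ ^ k := by
  induction k using Nat.twoStepInduction with
  | zero => rw [npow, pow_zero]; exact imp_self _
  | one => rw [npow, pow_one]
  | more k _ ih => rw [npow, pow_succ, ← ih]; rfl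

/-! ### Linearly ordered Wajsberg algebras of bounded exponent -/

section Chain

variable (htot : ∀ x y : A, x ≤ y ∨ y ≤ x) (hne : (1 : A) ≠ ∼1) {n : ℕ}
  (hn : ∀ x : A, x ^ n = x ^ (n + 1))
include htot hn

theorem pow_eq_neg_one {x : A} (hx : x ≠ 1) : x ^ n = ∼1 := by
  -- For `e = x ^ n`, `1 = e → e ⊗ x = x ∨ ¬e`.
  have h := imp_mul (x ^ n) x
  rw [← pow_succ, ← hn, imp_self, imp_imp_comm] at h
  rcases htot x (∼(x ^ n)) with h' | h'
  · rw [imp_imp_comm, le_def.1 h', one_imp] at h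
    rw [h, neg_neg']
  · rw [le_def.1 h', one_imp] at h
    exact absurd h.symm hx

include hne

/-- There is a largest element below `1`: otherwise every `y < 1` lies below the square of some
`u < 1`, hence below arbitrarily high powers of elements `u < 1`, which vanish. -/
theorem exists_coatom : ∃ c : A, c ≠ 1 ∧ ∀ x, x ≠ 1 → x ≤ c := by
  by_contra! hc
  have hroot : ∀ y : A, y ≠ 1 → ∃ u : A, u ≠ 1 ∧ y ≤ u ^ 2 := by
    intro y hy
    obtain ⟨z, hz, hzy⟩ := hc y hy
    have hyz : y ≤ z := (htot y z).resolve_right hzy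
    have hmul : z * (z ⇒ y) = y := mul_imp_self hyz
    rcases htot z (z ⇒ y) with h | h
    · refine ⟨z ⇒ y, hzy, ?_⟩
      calc y = z * (z ⇒ y) := hmul.symm
        _ ≤ (z ⇒ y) ^ 2 := by rw [sq]; exact mul_le_mul_left h _
    · refine ⟨z, hz, ?_⟩
      calc y = z * (z ⇒ y) := hmul.symm
        _ ≤ z ^ 2 := by rw [sq]; exact mul_le_mul_right h _
  obtain ⟨y, hy, hy0⟩ := hc (∼1) hne.symm
  have hpow : ∀ k : ℕ, ∃ u : A, u ≠ 1 ∧ y ≤ u ^ (k + 1) := by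
    intro k
    induction k with
    | zero => exact ⟨y, hy, by rw [zero_add, pow_one]⟩
    | succ k ih =>
      obtain ⟨u, hu, hyu⟩ := ih
      obtain ⟨w, hw, huw⟩ := hroot u hu
      refine ⟨w, hw, hyu.trans ?_⟩
      calc u ^ (k + 1) ≤ (w ^ 2) ^ (k + 1) := pow_le_pow_left' huw _
        _ = w ^ (2 * (k + 1)) := (pow_mul _ _ _).symm
        _ ≤ w ^ (k + 1 + 1) := pow_le_pow_right_of_le_one' (le_one' w) (by omega)
  obtain ⟨u, hu, hyu⟩ := hpow n
  rw [← hn, pow_eq_neg_one htot hn hu] at hyu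
  exact hy0 hyu

/-- A nontrivial linearly ordered Wajsberg algebra in which `x ^ n = x ^ (n + 1)` is isomorphic to
`ŁV_{m+1}` for some `1 ≤ m ≤ n`: it consists of the powers `c ^ k`, `k ≤ m`, of its coatom `c`,
and `c ^ k` corresponds to `1 - k / m`. -/
theorem exists_isHom_chain : ∃ m : ℕ, 0 < m ∧ m ≤ n ∧ ∃ f : A → chain m, IsHom f ∧
    (∀ x, (f x).1 = 1 ↔ x = 1) ∧ ∃ c, (f c).1 = 1 - 1 / m := by
  classical
  obtain ⟨c, hc1, hc⟩ := exists_coatom htot hne hn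
  have hex : ∃ k, c ^ k = ∼1 := ⟨n, pow_eq_neg_one htot hn hc1⟩
  obtain ⟨m, hm, hmin⟩ : ∃ m, c ^ m = ∼1 ∧ ∀ k, c ^ k = ∼1 → m ≤ k :=
    ⟨Nat.find hex, Nat.find_spec hex, fun k hk => Nat.find_min' hex hk⟩
  have hm0 : 0 < m := by
    rw [Nat.pos_iff_ne_zero]
    rintro rfl
    exact hne (by rw [← hm, pow_zero])
  have anti : ∀ {k l : ℕ}, k ≤ l → c ^ l ≤ c ^ k :=
    fun h => pow_le_pow_right_of_le_one' (le_one' c) h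
  -- `c ^ k = c ^ (k + 1)` forces `c ^ k = c ^ m = 0`.
  have stab : ∀ k, c ^ k ≤ c ^ (k + 1) → m ≤ k := by
    intro k hk
    have hk' : c ^ k = c ^ k * c := by
      rw [← pow_succ]; exact le_antisymm hk (anti (Nat.le_succ k))
    have h : ∀ j, c ^ (k + j) = c ^ k := by
      intro j
      induction j with
      | zero => rfl
      | succ j ih => rw [← add_assoc, pow_succ, ih, ← hk']
    refine hmin k (le_antisymm ?_ (neg_one_le _))
    rw [← h m, ← hm]
    exact anti (Nat.le_add_left m k)
  have inj : ∀ {k l : ℕ}, k ≤ m → l ≤ m → c ^ k = c ^ l → k = l := by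
    have key : ∀ {k l : ℕ}, l ≤ m → c ^ k = c ^ l → l ≤ k := by
      intro k l hl h
      by_contra! hkl
      have := stab k (h.le.trans (anti hkl))
      omega
    intro k l hk hl h
    exact le_antisymm (key hk h.symm) (key hl h)
  have surj : ∀ x : A, ∃ k, k ≤ m ∧ x = c ^ k := by
    intro x
    by_contra! hx
    have h : ∀ k, k ≤ m → x ≤ c ^ k := by
      intro k
      induction k with
      | zero => intro _; rw [pow_zero]; exact le_one' x
      | succ k ih =>
        intro hk
        have hxk := ih (Nat.le_of_succ_le hk)
        have hlt : c ^ k ⇒ x ≠ 1 := fun h =>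
          hx k (Nat.le_of_succ_le hk) (le_antisymm hxk h)
        calc x = c ^ k * (c ^ k ⇒ x) := (mul_imp_self hxk).symm
          _ ≤ c ^ k * c := mul_le_mul_right (hc _ hlt) _
          _ = c ^ (k + 1) := (pow_succ c k).symm
    refine hx m le_rfl (le_antisymm (h m le_rfl) ?_)
    rw [hm]
    exact neg_one_le x
  have imp_pow : ∀ k l, l ≤ m → c ^ k ⇒ c ^ l = c ^ (l - k) := by
    intro k l hl
    rcases le_total l k with h | h
    · rw [Nat.sub_eq_zero_of_le h, pow_zero]
      exact anti h
    · have hsplit : c ^ l = c ^ k * c ^ (l - k) := by rw [← pow_add, Nat.add_sub_cancel' h]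
      obtain ⟨m', -, h'⟩ := surj (∼(c ^ k))
      -- No truncation occurs, as `¬ c ^ k` is a power `c ^ m'` with `m ≤ k + m'`.
      have hle : ∼(c ^ k) ≤ c ^ (l - k) := by
        rw [h']
        refine anti ?_
        have : m ≤ k + m' := hmin _ <| by
          rw [pow_add, ← h', mul_def, neg_neg', imp_self]
        omega
      rw [hsplit, imp_mul, imp_imp_comm, le_def.1 hle, one_imp]
  choose d hd hdc using surj
  have hd_eq : ∀ {x k}, k ≤ m → x = c ^ k → d x = k := fun hk hx =>
    inj (hd _) hk ((hdc _).symm.trans hx)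
  have hmQ : (0 : ℚ) < m := by exact_mod_cast hm0
  have hdQ : ∀ x, (d x : ℚ) ≤ m := fun x => by exact_mod_cast hd x
  have d_imp : ∀ x y, d (x ⇒ y) = d y - d x := fun x y =>
    hd_eq ((Nat.sub_le _ _).trans (hd y)) (by
      rw [← imp_pow _ _ (hd y), ← hdc, ← hdc])
  have d_neg : ∀ x, d (∼x) = m - d x := fun x =>
    hd_eq (Nat.sub_le _ _) (by rw [← imp_pow _ _ le_rfl, ← hdc, hm, ← neg_eq])
  have d_one : d 1 = 0 := hd_eq (Nat.zero_le m) (pow_zero c).symm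
  refine ⟨m, hm0, hmin n (pow_eq_neg_one htot hn hc1), fun x => ⟨1 - d x / m, ?_, ?_, ?_⟩,
    ⟨fun x => ?_, fun x y => ?_⟩, fun x => ?_, c, ?_⟩
  · exact sub_nonneg.2 ((div_le_one hmQ).2 (hdQ x))
  · have : (0 : ℚ) ≤ d x / m := by positivity
    linarith
  · exact ⟨m - d x, by push_cast; field_simp⟩
  · apply Subtype.ext
    change 1 - ((d (∼x) : ℕ) : ℚ) / m = 1 - (1 - (d x : ℚ) / m)
    rw [d_neg, Nat.cast_sub (hd x)]
    field_simp
  · apply Subtype.ext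
    change 1 - ((d (x ⇒ y) : ℕ) : ℚ) / m = min 1 (1 - (1 - (d x : ℚ) / m) + (1 - (d y : ℚ) / m))
    rw [d_imp]
    rcases le_total (d y) (d x) with h | h
    · have h' : (d y : ℚ) / m ≤ (d x : ℚ) / m := by gcongr
      rw [Nat.sub_eq_zero_of_le h, min_eq_left (by linarith)]
      simp
    · have h' : (d x : ℚ) / m ≤ (d y : ℚ) / m := by gcongr
      rw [Nat.cast_sub h, min_eq_right (by linarith)]
      ring
  · change 1 - (d x : ℚ) / m = 1 ↔ x = 1
    constructor
    · intro h
      have h0 : (d x : ℚ) = 0 := by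
        have : (d x : ℚ) / m = 0 := by linarith
        simpa [hmQ.ne'] using this
      rw [hdc x, Nat.cast_eq_zero.1 h0, pow_zero]
    · rintro rfl
      simp [d_one]
  · change 1 - (d c : ℚ) / m = 1 - 1 / m
    rw [hd_eq hm0 (pow_one c).symm, Nat.cast_one]

end Chain
end WajsbergAlgebra

/-! ### Lindenbaum algebras -/

/-- Theories of the infinite-valued Łukasiewicz logic: sets of formulas that contain the instances
of the four axiom schemas and are closed under modus ponens. -/
structure IsLukTheory (T : Set Formula) : Prop where
  weakening : ∀ φ ψ, imp φ (imp ψ φ) ∈ T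
  suffixing : ∀ φ ψ χ, imp (imp φ ψ) (imp (imp ψ χ) (imp φ χ)) ∈ T
  joinComm : ∀ φ ψ, imp (imp (imp φ ψ) ψ) (imp (imp ψ φ) φ) ∈ T
  contraposition : ∀ φ ψ, imp (imp (neg φ) (neg ψ)) (imp ψ φ) ∈ T
  mp : ∀ {φ ψ}, φ ∈ T → imp φ ψ ∈ T → ψ ∈ T

namespace IsLukTheory

variable {T : Set Formula} (hT : IsLukTheory T)
include hT

theorem trans {φ ψ χ : Formula} (h₁ : imp φ ψ ∈ T) (h₂ : imp ψ χ ∈ T) : imp φ χ ∈ T :=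
  hT.mp h₂ (hT.mp h₁ (hT.suffixing φ ψ χ))

theorem imp_join (φ ψ : Formula) : imp φ (imp (imp φ ψ) ψ) ∈ T :=
  hT.trans (hT.weakening φ (imp ψ φ)) (hT.joinComm ψ φ)

theorem swap {φ ψ χ : Formula} (h : imp φ (imp ψ χ) ∈ T) : imp ψ (imp φ χ) ∈ T :=
  hT.trans (hT.imp_join ψ χ) (hT.mp h (hT.suffixing φ (imp ψ χ) χ))

theorem refl (φ : Formula) : imp φ φ ∈ T :=
  hT.mp (hT.weakening φ φ) (hT.swap (hT.weakening φ (imp φ (imp φ φ))))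

theorem neg_neg_imp (φ : Formula) : imp (neg (neg φ)) φ ∈ T := by
  have h := hT.trans (hT.trans (hT.weakening (neg (neg φ)) (neg (neg (imp φ φ))))
    (hT.contraposition (neg (imp φ φ)) (neg φ))) (hT.contraposition φ (imp φ φ))
  exact hT.mp (hT.refl φ) (hT.swap h)

theorem imp_neg_neg (φ : Formula) : imp φ (neg (neg φ)) ∈ T :=
  hT.mp (hT.neg_neg_imp (neg φ)) (hT.contraposition (neg (neg φ)) φ)

theorem neg_imp_neg {φ ψ : Formula} (h : imp φ ψ ∈ T) : imp (neg ψ) (neg φ) ∈ T :=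
  hT.mp (hT.trans (hT.trans (hT.neg_neg_imp φ) h) (hT.imp_neg_neg ψ))
    (hT.contraposition (neg φ) (neg ψ))

theorem imp_imp_imp {φ φ' ψ ψ' : Formula} (h : imp φ' φ ∈ T) (h' : imp ψ ψ' ∈ T) :
    imp (imp φ ψ) (imp φ' ψ') ∈ T :=
  hT.trans (hT.mp h (hT.suffixing φ' φ ψ)) (hT.mp h' (hT.swap (hT.suffixing φ' ψ ψ')))

/-- Equivalence of formulas modulo a theory. -/
def setoid : Setoid Formula where
  r φ ψ := imp φ ψ ∈ T ∧ imp ψ φ ∈ T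
  iseqv := ⟨fun φ => ⟨hT.refl φ, hT.refl φ⟩, fun h => ⟨h.2, h.1⟩,
    fun h₁ h₂ => ⟨hT.trans h₁.1 h₂.1, hT.trans h₂.2 h₁.2⟩⟩

/-- The Lindenbaum algebra of a theory. -/
def Lindenbaum : Type := Quotient hT.setoid

/-- The class of a formula in the Lindenbaum algebra. -/
def cls (φ : Formula) : hT.Lindenbaum := Quotient.mk hT.setoid φ

omit hT in
theorem cls_eq_mk {hT : IsLukTheory T} {φ ψ : Formula} :
    hT.cls φ = hT.cls ψ ↔ imp φ ψ ∈ T ∧ imp ψ φ ∈ T :=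
  Quotient.eq (r := hT.setoid)

instance : Alg hT.Lindenbaum where
  neg := Quotient.map neg fun _ _ h => ⟨hT.neg_imp_neg h.2, hT.neg_imp_neg h.1⟩
  imp := Quotient.map₂ imp fun _ _ h _ _ h' =>
    ⟨hT.imp_imp_imp h.2 h'.1, hT.imp_imp_imp h.1 h'.2⟩

instance : One hT.Lindenbaum := ⟨hT.cls (imp (var 0) (var 0))⟩

omit hT in
theorem cls_eq_one {hT : IsLukTheory T} {φ : Formula} : hT.cls φ = 1 ↔ φ ∈ T := by
  change hT.cls φ = hT.cls (imp (var 0) (var 0)) ↔ _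
  rw [cls_eq_mk]
  exact ⟨fun h => hT.mp (hT.refl _) h.2,
    fun h => ⟨hT.mp (hT.refl _) (hT.weakening _ _), hT.mp h (hT.weakening _ _)⟩⟩

theorem cls_surjective (x : hT.Lindenbaum) : ∃ φ, hT.cls φ = x := Quotient.exists_rep x

instance : WajsbergAlgebra hT.Lindenbaum where
  one_imp x := by
    obtain ⟨φ, rfl⟩ := hT.cls_surjective x
    exact cls_eq_mk.2 ⟨hT.mp (hT.refl _) (hT.imp_join _ φ), hT.weakening _ _⟩
  imp_imp_imp x y z := by
    obtain ⟨φ, rfl⟩ := hT.cls_surjective x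
    obtain ⟨ψ, rfl⟩ := hT.cls_surjective y
    obtain ⟨χ, rfl⟩ := hT.cls_surjective z
    exact cls_eq_one.2 (hT.suffixing φ ψ χ)
  imp_imp_comm x y := by
    obtain ⟨φ, rfl⟩ := hT.cls_surjective x
    obtain ⟨ψ, rfl⟩ := hT.cls_surjective y
    exact cls_eq_mk.2 ⟨hT.joinComm φ ψ, hT.joinComm ψ φ⟩
  neg_imp_neg_imp x y := by
    obtain ⟨φ, rfl⟩ := hT.cls_surjective x
    obtain ⟨ψ, rfl⟩ := hT.cls_surjective y
    exact cls_eq_one.2 (hT.contraposition φ ψ)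

theorem eval_cls (φ : Formula) : eval (fun k => hT.cls (var k)) φ = hT.cls φ := by
  induction φ with
  | var k => rfl
  | neg φ ih => rw [eval, ih]; rfl
  | imp φ ψ ih₁ ih₂ => rw [eval, ih₁, ih₂]; rfl

end IsLukTheory

/-! ### Prime theories of the finite-valued calculi -/

/-- The substitution that sends the first three variables to `φ`, `ψ`, `χ`. -/
def subst₃ (φ ψ χ : Formula) : ℕ → Formula
  | 0 => φ
  | 1 => ψ
  | _ => χ

theorem isLukTheory_derives (n : ℕ) (Γ : Set Formula) :
    IsLukTheory {φ | Derives (lukRules n) Γ φ} := by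
  have hsub : lukInftyRules ⊆ lukRules n := fun r hr => Or.inl (Or.inl hr)
  have ax : ∀ φ, ⟨[], φ⟩ ∈ lukInftyRules → ∀ s, Derives (lukRules n) Γ (subst s φ) :=
    fun φ h s => .app ⟨[], φ⟩ s (hsub h) (by simp)
  constructor
  · exact fun φ ψ => ax _ (Or.inl rfl) (subst₃ φ ψ ψ)
  · exact fun φ ψ χ => ax _ (Or.inr (Or.inl rfl)) (subst₃ φ ψ χ)
  · exact fun φ ψ => ax _ (Or.inr (Or.inr (Or.inl rfl))) (subst₃ φ ψ ψ)
  · exact fun φ ψ => ax _ (Or.inr (Or.inr (Or.inr (Or.inl rfl)))) (subst₃ φ ψ ψ)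
  · intro φ ψ h₁ h₂
    refine .app ⟨[var 0, imp (var 0) (var 1)], var 1⟩ (subst₃ φ ψ ψ)
      (hsub (Or.inr (Or.inr (Or.inr (Or.inr rfl))))) ?_
    intro χ hχ
    simp only [List.mem_cons, List.not_mem_nil, or_false] at hχ
    rcases hχ with rfl | rfl
    · exact h₁
    · exact h₂

theorem lukRules_cases {n : ℕ} {r : Rule} (hr : r ∈ lukRules n) :
    r.prems = [] ∨ r = ⟨[var 0, imp (var 0) (var 1)], var 1⟩ := by
  simp only [lukRules, lukInftyRules, iffAxioms, Set.mem_union, Set.mem_iUnion,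
    Set.mem_insert_iff, Set.mem_singleton_iff] at hr
  rcases hr with ((rfl | rfl | rfl | rfl | rfl) | (rfl | rfl)) | ⟨p, -, (rfl | rfl)⟩ <;> simp

/-- Derivability has finite character, in the form needed for Zorn's lemma. -/
theorem Derives.of_sUnion {R : Set Rule} {c : Set (Set Formula)} (hc : IsChain (· ⊆ ·) c)
    (hne : c.Nonempty) {φ : Formula} (h : Derives R (⋃₀ c) φ) : ∃ Γ ∈ c, Derives R Γ φ := by
  induction h with
  | hyp φ hφ =>
    obtain ⟨Γ, hΓ, hφΓ⟩ := hφ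
    exact ⟨Γ, hΓ, .hyp φ hφΓ⟩
  | app r s hr _ ih =>
    have key : ∀ l : List Formula, (∀ φ ∈ l, ∃ Γ ∈ c, Derives R Γ (subst s φ)) →
        ∃ Γ ∈ c, ∀ φ ∈ l, Derives R Γ (subst s φ) := by
      intro l
      induction l with
      | nil => exact fun _ => hne.imp fun Γ hΓ => ⟨hΓ, by simp⟩
      | cons φ l ihl =>
        intro h
        obtain ⟨Γ, hΓ, hφ⟩ := h φ (by simp)
        obtain ⟨Δ, hΔ, hl⟩ := ihl fun ψ hψ => h ψ (by simp [hψ])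
        rcases hc.total hΓ hΔ with hle | hle
        · refine ⟨Δ, hΔ, List.forall_mem_cons.2 ⟨?_, hl⟩⟩
          exact (isLogic_derives R).mono _ _ _ hle hφ
        · refine ⟨Γ, hΓ, List.forall_mem_cons.2 ⟨hφ, fun ψ hψ => ?_⟩⟩
          exact (isLogic_derives R).mono _ _ _ hle (hl ψ hψ)
    obtain ⟨Γ, hΓ, h⟩ := key r.prems ih
    exact ⟨Γ, hΓ, .app r s hr h⟩

/-- Proof by cases: if `u ∨ z` belongs to the theory `T` and `φ` is derivable from `T` and `u`, then
`φ ∨ z` belongs to `T`. -/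
theorem join_eq_one_of_derives {n : ℕ} {T : Set Formula} (hT : IsLukTheory T)
    (hcl : ∀ φ, Derives (lukRules n) T φ → φ ∈ T) {u φ : Formula} {z : hT.Lindenbaum}
    (hz : (hT.cls u ⇒ z) ⇒ z = 1) (h : Derives (lukRules n) (insert u T) φ) :
    (hT.cls φ ⇒ z) ⇒ z = 1 := by
  have of_mem : ∀ φ ∈ T, (hT.cls φ ⇒ z) ⇒ z = 1 := fun φ hφ => by
    rw [IsLukTheory.cls_eq_one.2 hφ, WajsbergAlgebra.one_imp, WajsbergAlgebra.imp_self]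
  induction h with
  | hyp φ hφ =>
    rcases hφ with rfl | hφ
    · exact hz
    · exact of_mem φ hφ
  | app r s hr _ ih =>
    rcases lukRules_cases hr with h | rfl
    · exact of_mem _ (hcl _ (.app r s hr (by simp [h])))
    · exact WajsbergAlgebra.join_mp (ih (var 0) (by simp)) (ih (imp (var 0) (var 1)) (by simp))

/-- A set from which `φ` is not derivable is contained in a deductively closed set that omits `φ`
and whose Lindenbaum algebra is linearly ordered. -/
theorem exists_prime_theory {n : ℕ} {Γ : Set Formula} {φ : Formula}
    (h : ¬ Derives (lukRules n) Γ φ) : ∃ T : Set Formula, IsLukTheory T ∧ Γ ⊆ T ∧ φ ∉ T ∧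
      (∀ ψ, Derives (lukRules n) T ψ → ψ ∈ T) ∧ ∀ x y, imp x y ∈ T ∨ imp y x ∈ T := by
  obtain ⟨T, hΓT, hTφ, hmax⟩ := zorn_subset_nonempty {T | ¬ Derives (lukRules n) T φ}
    (fun c hc hchain hne => ⟨⋃₀ c, fun hφ => by
      obtain ⟨Δ, hΔ, hφΔ⟩ := hφ.of_sUnion hchain hne
      exact hc hΔ hφΔ, fun _ => Set.subset_sUnion_of_mem⟩) Γ h
  have hins : ∀ u, u ∉ T → Derives (lukRules n) (insert u T) φ := by
    intro u hu
    by_contra hφ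
    exact hu (hmax hφ (Set.subset_insert u T) (Set.mem_insert u T))
  have hcl : ∀ ψ, Derives (lukRules n) T ψ → ψ ∈ T := by
    intro ψ hψ
    by_contra hψT
    refine hTφ ((hins ψ hψT).cut ?_)
    rintro χ (rfl | hχ)
    · exact hψ
    · exact .hyp χ hχ
  have hT : IsLukTheory T := by
    have heq : {ψ | Derives (lukRules n) T ψ} = T :=
      Set.Subset.antisymm hcl fun ψ hψ => .hyp ψ hψ
    rw [← heq]
    exact isLukTheory_derives n T
  refine ⟨T, hT, hΓT, fun hφ => hTφ (.hyp φ hφ), hcl, fun x y => ?_⟩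
  by_contra! hxy
  have h₁ := join_eq_one_of_derives hT hcl (u := imp x y) (z := hT.cls (imp y x))
    (WajsbergAlgebra.join_imp_imp (hT.cls x) (hT.cls y)) (hins _ hxy.1)
  rw [WajsbergAlgebra.imp_imp_comm] at h₁
  have h₂ := join_eq_one_of_derives hT hcl h₁ (hins _ hxy.2)
  rw [WajsbergAlgebra.join_self] at h₂
  exact hTφ (.hyp φ (IsLukTheory.cls_eq_one.1 h₂))

/-! ### Strong completeness of Grigolia's calculus -/

/-- The linearly ordered Lindenbaum algebra of a prime theory is a chain `ŁV_{m+1}` with `m ≤ n`.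
Grigolia's schema for `p = m` fails in `ŁV_{m+1}` at `1 - 1/m`, so that `m ∣ n`, and then the chain
embeds in `ŁV_{n+1}`. -/
theorem exists_valuation_of_not_derives {n : ℕ} {Γ : Set Formula} {φ : Formula}
    (h : ¬ Derives (lukRules n) Γ φ) :
    ∃ v : ℕ → chain n, (∀ ψ ∈ Γ, (eval v ψ).1 = 1) ∧ (eval v φ).1 ≠ 1 := by
  obtain ⟨T, hT, hΓT, hφT, hcl, hprime⟩ := exists_prime_theory h
  have ax : ∀ χ, ⟨[], χ⟩ ∈ lukRules n → ∀ s, subst s χ ∈ T :=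
    fun χ hχ s => hcl _ (.app ⟨[], χ⟩ s hχ (by simp))
  have htot : ∀ x y : hT.Lindenbaum, x ≤ y ∨ y ≤ x := by
    intro x y
    obtain ⟨φ, rfl⟩ := hT.cls_surjective x
    obtain ⟨ψ, rfl⟩ := hT.cls_surjective y
    exact (hprime φ ψ).imp IsLukTheory.cls_eq_one.2 IsLukTheory.cls_eq_one.2
  have hne : (1 : hT.Lindenbaum) ≠ ∼1 := fun h01 => by
    refine hφT ((IsLukTheory.cls_eq_one (hT := hT)).1 (WajsbergAlgebra.one_le_iff.1 ?_))
    rw [h01]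
    exact WajsbergAlgebra.neg_one_le _
  have hpow : ∀ x : hT.Lindenbaum, x ^ n = x ^ (n + 1) := by
    intro x
    obtain ⟨φ, rfl⟩ := hT.cls_surjective x
    have hax : ∀ χ, ⟨[], χ⟩ ∈ lukRules n → eval (fun _ => hT.cls φ) χ = 1 := by
      intro χ hχ
      have := (IsLukTheory.cls_eq_one (hT := hT)).2 (ax χ hχ fun _ => φ)
      rwa [← hT.eval_cls, eval_subst, hT.eval_cls] at this
    have h₁ := hax (imp (npow n (var 0)) (npow (n + 1) (var 0)))
      (Or.inl (Or.inr (Or.inl rfl)))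
    have h₂ := hax (imp (npow (n + 1) (var 0)) (npow n (var 0)))
      (Or.inl (Or.inr (Or.inr rfl)))
    rw [eval, WajsbergAlgebra.eval_npow, WajsbergAlgebra.eval_npow] at h₁ h₂
    exact le_antisymm h₁ h₂
  obtain ⟨m, hm0, hmn, f, hf, hf1, x, hx⟩ :=
    WajsbergAlgebra.exists_isHom_chain htot hne hpow
  obtain ⟨χ, rfl⟩ := hT.cls_surjective x
  have hfv : ∀ ψ, f (hT.cls ψ) = eval (fun k => f (hT.cls (var k))) ψ := fun ψ => by
    rw [← hf.eval, hT.eval_cls]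
  have hmem : ∀ ψ, (eval (fun k => f (hT.cls (var k))) ψ).1 = 1 ↔ ψ ∈ T := fun ψ => by
    rw [← hfv, hf1, IsLukTheory.cls_eq_one]
  have hdvd : m ∣ n := by
    by_contra hndvd
    have hm2 : 2 ≤ m := by
      by_contra! hlt
      exact hndvd ((show m = 1 by omega) ▸ one_dvd n)
    have hlt : m < n := lt_of_le_of_ne hmn fun h => hndvd (h ▸ dvd_rfl)
    have h := (hmem _).2 (ax (imp (npow (n + 1) (nmul m (npow (m - 1) (var 0))))
      (nmul (n + 1) (npow m (var 0)))) (Or.inr (by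
        simp only [Set.mem_iUnion]
        exact ⟨m, ⟨hm2, hlt, hndvd⟩, Or.inl rfl⟩)) fun _ => χ)
    rw [hfv] at hx
    have hmQ : (0 : ℚ) < m := by exact_mod_cast hm0
    rw [eval_subst, eval_imp, eval_npow, eval_nmul, eval_npow, eval_nmul, eval_npow] at h
    simp only [eval, hx] at h
    have e₁ : (1 : ℚ) - m * (1 - (1 - 1 / m)) = 0 := by field_simp; ring
    have e₂ : (1 : ℚ) - ((m - 1 : ℕ) : ℚ) * (1 - (1 - 1 / m)) = 1 / m := by
      rw [Nat.cast_sub hm0]; field_simp; push_cast; ring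
    have e₃ : max (0 : ℚ) (1 / m) = 1 / m := max_eq_right (by positivity)
    rw [e₁, e₂, e₃, mul_one_div_cancel hmQ.ne'] at h
    norm_num at h
  refine ⟨fun k => chainIncl hdvd (f (hT.cls (var k))), fun ψ hψ => ?_, fun hφ => ?_⟩
  · rw [← (isHom_chainIncl hdvd).eval]
    exact (hmem ψ).2 (hΓT hψ)
  · rw [← (isHom_chainIncl hdvd).eval] at hφ
    exact hφT ((hmem φ).1 hφ)

theorem lukRules_sound {n : ℕ} (hn : 0 < n) {r : Rule} (hr : r ∈ lukRules n)
    (v : ℕ → chain n) (hv : ∀ φ ∈ r.prems, (eval v φ).1 = 1) : (eval v r.concl).1 = 1 := by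
  have hnQ : (0 : ℚ) < n := by exact_mod_cast hn
  have h0 := chain_nonneg (v 0)
  have h0' := chain_le_one (v 0)
  have h1 := chain_nonneg (v 1)
  have h1' := chain_le_one (v 1)
  have h2 := chain_nonneg (v 2)
  have h2' := chain_le_one (v 2)
  have imp_eq : ∀ {φ ψ}, (eval v (imp φ ψ)).1 = 1 ↔ (eval v φ).1 ≤ (eval v ψ).1 := by
    intro φ ψ
    rw [eval_imp, min_eq_left_iff]
    exact ⟨fun h => by linarith, fun h => by linarith⟩
  have iff_eq : ∀ {φ ψ}, r ∈ iffAxioms φ ψ → (eval v φ).1 = (eval v ψ).1 →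
      (eval v r.concl).1 = 1 := by
    rintro φ ψ (rfl | rfl) h
    · exact imp_eq.2 h.le
    · exact imp_eq.2 h.ge
  obtain ⟨a, ha, hav⟩ := (mem_chain_iff hn _).1 (v 0).2
  obtain ⟨b, rfl⟩ := Nat.exists_eq_add_of_le ha
  have hb : 1 - (v 0).1 = b / ((a + b : ℕ) : ℚ) := by
    rw [hav]; field_simp; push_cast; ring
  rcases hr with (hr | hr) | hr
  · rcases hr with rfl | rfl | rfl | rfl | rfl
    · simp only [eval_imp, eval_var, min_def]
      split_ifs <;> linarith
    · simp only [eval_imp, eval_var, min_def]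
      split_ifs <;> linarith
    · simp only [eval_imp, eval_var, min_def]
      split_ifs <;> linarith
    · simp only [eval_imp, eval_neg, eval_var, min_def]
      split_ifs <;> linarith
    · have e₁ := hv (var 0) (by simp)
      have e₂ := imp_eq.1 (hv (imp (var 0) (var 1)) (by simp))
      exact le_antisymm h1' (e₁.symm.trans_le e₂)
  · refine iff_eq hr ?_
    rw [eval_npow, eval_npow]
    simp only [eval]
    rw [hb]
    rcases Nat.eq_zero_or_pos b with rfl | hb0
    · simp
    · have hbQ : (1 : ℚ) ≤ b := by exact_mod_cast hb0
      have e : ((a + b : ℕ) : ℚ) * (b / ((a + b : ℕ) : ℚ)) = b := by field_simp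
      have e' : (0 : ℚ) ≤ b / ((a + b : ℕ) : ℚ) := by positivity
      rw [max_eq_left (by linarith), max_eq_left]
      rw [Nat.cast_add (a + b) 1, add_mul, e, Nat.cast_one, one_mul]
      linarith
  · simp only [Set.mem_iUnion] at hr
    obtain ⟨p, ⟨hp2, hpn, hpd⟩, hr⟩ := hr
    refine iff_eq hr ?_
    rw [eval_npow, eval_nmul, eval_npow, eval_nmul, eval_npow]
    simp only [eval]
    rw [hb]
    have hpQ : (2 : ℚ) ≤ p := by exact_mod_cast hp2
    -- With `y = b / n = 1 - v 0`, both sides are `1` if `p y < 1` and `0` if `p y > 1`;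
    -- `p y = 1` is excluded by `p ∤ n`.
    set y := (b : ℚ) / ((a + b : ℕ) : ℚ) with hy
    have hny : ((a + b : ℕ) : ℚ) * y = b := by rw [hy]; field_simp
    have hp1 : ((p - 1 : ℕ) : ℚ) = p - 1 := by rw [Nat.cast_sub (by omega)]; simp
    have hn1 : ((a + b + 1 : ℕ) : ℚ) = ((a + b : ℕ) : ℚ) + 1 := by push_cast; ring
    rw [hp1, hn1]
    rcases lt_trichotomy (p * b) (a + b) with hlt | heq | hgt
    · have hlt' : (p : ℚ) * b + 1 ≤ ((a + b : ℕ) : ℚ) := by exact_mod_cast hlt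
      have hpy : p * y + 1 / ((a + b : ℕ) : ℚ) ≤ 1 := by
        rw [hy, mul_div_assoc', ← add_div]
        exact (div_le_one hnQ).2 hlt'
      have hinv : 0 < 1 / ((a + b : ℕ) : ℚ) := by positivity
      have hinv' : ((a + b : ℕ) : ℚ) * (1 / ((a + b : ℕ) : ℚ)) = 1 := by field_simp
      have hA : 1 ≤ (p : ℚ) * max 0 (1 - (p - 1) * y) := by
        refine le_trans ?_ (mul_le_mul_of_nonneg_left (le_max_right _ _) (by linarith))
        nlinarith
      have hB : 1 ≤ (((a + b : ℕ) : ℚ) + 1) * max 0 (1 - p * y) := by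
        refine le_trans ?_ (mul_le_mul_of_nonneg_left (le_max_right _ _) (by linarith))
        nlinarith
      rw [min_eq_left hA, min_eq_left hB]
      simp
    · exact absurd ⟨b, heq.symm⟩ hpd
    · have hgt' : ((a + b : ℕ) : ℚ) + 1 ≤ p * b := by exact_mod_cast hgt
      have hpy : 1 + 1 / ((a + b : ℕ) : ℚ) ≤ p * y := by
        have : 1 + 1 / ((a + b : ℕ) : ℚ) = (((a + b : ℕ) : ℚ) + 1) / ((a + b : ℕ) : ℚ) := by
          field_simp
        rw [this, hy, mul_div_assoc']
        exact div_le_div_of_nonneg_right hgt' hnQ.le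
      have hinv : 0 < 1 / ((a + b : ℕ) : ℚ) := by positivity
      have hinv' : ((a + b : ℕ) : ℚ) * (1 / ((a + b : ℕ) : ℚ)) = 1 := by field_simp
      have hA : (p : ℚ) * max 0 (1 - (p - 1) * y) ≤ 1 - 1 / ((a + b : ℕ) : ℚ) := by
        have hle : 1 / ((a + b : ℕ) : ℚ) ≤ 1 := by
          refine (div_le_one hnQ).2 ?_
          exact_mod_cast hn
        rcases max_choice (0 : ℚ) (1 - (p - 1) * y) with h | h <;> rw [h]
        · linarith
        · nlinarith
      have hB : max (0 : ℚ) (1 - p * y) = 0 := max_eq_left (by linarith)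
      rw [hB, min_eq_right (by linarith), mul_zero, min_eq_right zero_le_one]
      refine max_eq_left ?_
      nlinarith

/-- Strong completeness of Grigolia's calculus. -/
theorem axiomatizes_lukRules {n : ℕ} (hn : 0 < n) : Axiomatizes (lukRules n) (L n n) := by
  intro Γ φ
  constructor
  · refine (isLogic_matrixLogic _ _).of_derives fun r hr v hv => ?_
    rw [mem_orderFilter_self hn]
    exact lukRules_sound hn hr v fun ψ hψ => (mem_orderFilter_self hn _).1 (hv ψ hψ)
  · intro h
    by_contra hφ
    obtain ⟨v, hv, hvφ⟩ := exists_valuation_of_not_derives hφ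
    exact hvφ ((mem_orderFilter_self hn _).1
      (h v fun ψ hψ => (mem_orderFilter_self hn _).2 (hv ψ hψ)))

/-! ### The translated calculi -/

theorem subst_lam (s : ℕ → Formula) (m n : ℕ) (φ : Formula) :
    subst s (lam m n φ) = lam m n (subst s φ) := by
  induction n generalizing m with
  | zero => cases m <;> rfl
  | succ n ih =>
    cases m with
    | zero => rfl
    | succ m => simp only [lam, otimes, oplus, subst, ih]

/-- On `ŁV_{n+1}`, the term `λ_{i,n}` is the characteristic function of `F_{i/n}`. -/
theorem eval_lam_eq_ite {n : ℕ} (hn : 0 < n) (v : ℕ → chain n) (φ : Formula) (i : ℕ) :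
    (eval v (lam i n φ)).1 = if (i : ℚ) / n ≤ (eval v φ).1 then 1 else 0 := by
  obtain ⟨k, -, hk⟩ := (mem_chain_iff hn _).1 (eval v φ).2
  have hnQ : (0 : ℚ) < n := by exact_mod_cast hn
  rw [eval_lam, hk, mul_div_cancel₀ _ hnQ.ne']
  simp only [div_le_div_iff_of_pos_right hnQ]
  split_ifs with h
  · rw [min_eq_left (by linarith), max_eq_right zero_le_one]
  · have h' : k + 1 ≤ i := by exact_mod_cast not_le.1 h
    have h'' : (k : ℚ) + 1 ≤ i := by exact_mod_cast h'
    rw [min_eq_right (by linarith), max_eq_left (by linarith)]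

theorem isBool_lam {n : ℕ} (hn : 0 < n) (v : ℕ → chain n) (φ : Formula) (i : ℕ) :
    IsBool (eval v (lam i n φ)) := by
  rw [IsBool, eval_lam_eq_ite hn]
  split_ifs <;> simp

theorem eval_lam_eq_one_iff {n : ℕ} (hn : 0 < n) (v : ℕ → chain n) (φ : Formula) (i : ℕ) :
    (eval v (lam i n φ)).1 = 1 ↔ eval v φ ∈ orderFilter n i := by
  rw [eval_lam_eq_ite hn]
  simp [orderFilter]

theorem eval_lam_self_mem {n i : ℕ} (hi : 0 < i) (hin : i ≤ n) (v : ℕ → chain n) (φ : Formula) :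
    eval v (lam n n φ) ∈ orderFilter n i ↔ (eval v φ).1 = 1 := by
  have hn := hi.trans_le hin
  rw [(isBool_lam hn v φ n).mem_orderFilter hi hin, eval_lam_eq_one_iff hn,
    mem_orderFilter_self hn]

theorem Derives.translate {n i : ℕ} (hin : i ≠ n) {Γ : Set Formula} {φ : Formula}
    (h : Derives (lukRules n) Γ φ) : Derives (H n i) (lam n n '' Γ) (lam n n φ) := by
  induction h with
  | hyp φ hφ => exact .hyp _ ⟨φ, hφ, rfl⟩
  | app r s hr _ ih =>
    rw [← subst_lam]
    refine .app ⟨r.prems.map (lam n n), lam n n r.concl⟩ s ?_ ?_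
    · rw [H, if_neg hin]
      exact Or.inl ⟨r, hr, rfl⟩
    · intro χ hχ
      obtain ⟨ψ, hψ, rfl⟩ := List.mem_map.1 hχ
      rw [subst_lam]
      exact ih ψ hψ

/-- `φ ↦ λ_{i,n}(φ)` interprets the logic with filter `F_{i/n}` in the one with filter `{1}`,
`φ ↦ λ_{n,n}(φ)` goes back, and the two extra rules of the calculus say that the composite is
equivalent to the identity. Hence completeness transfers. -/
theorem axiomatizes_H {n i : ℕ} (hi : 0 < i) (hin : i ≤ n) : Axiomatizes (H n i) (L n i) := by
  have hn := hi.trans_le hin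
  rcases eq_or_ne i n with rfl | hne
  · rw [H, if_pos rfl]
    exact axiomatizes_lukRules hn
  have there : (⟨[var 0], lam n n (lam i n (var 0))⟩ : Rule) ∈ H n i := by
    rw [H, if_neg hne]
    exact Or.inr (Or.inl rfl)
  have back : (⟨[lam n n (lam i n (var 0))], var 0⟩ : Rule) ∈ H n i := by
    rw [H, if_neg hne]
    exact Or.inr (Or.inr rfl)
  intro Γ φ
  constructor
  · refine (isLogic_matrixLogic _ _).of_derives fun r hr v hv => ?_
    rw [H, if_neg hne] at hr
    rcases hr with ⟨r, hr, rfl⟩ | rfl | rfl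
    · refine (eval_lam_self_mem hi hin v _).2 (lukRules_sound hn hr v fun ψ hψ => ?_)
      exact (eval_lam_self_mem hi hin v ψ).1 (hv _ (List.mem_map_of_mem hψ))
    · rw [eval_lam_self_mem hi hin, eval_lam_eq_one_iff hn]
      exact hv (var 0) (List.mem_singleton.2 rfl)
    · have := hv (lam n n (lam i n (var 0))) (List.mem_singleton.2 rfl)
      rwa [eval_lam_self_mem hi hin, eval_lam_eq_one_iff hn] at this
  · intro h
    have hτ : Derives (lukRules n) (lam i n '' Γ) (lam i n φ) := by
      refine (axiomatizes_lukRules hn _ _).2 fun v hv => ?_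
      rw [mem_orderFilter_self hn, eval_lam_eq_one_iff hn]
      refine h v fun ψ hψ => ?_
      have := hv _ ⟨ψ, hψ, rfl⟩
      rwa [mem_orderFilter_self hn, eval_lam_eq_one_iff hn] at this
    have hσ : Derives (H n i) Γ (lam n n (lam i n φ)) := by
      refine (hτ.translate hne).cut ?_
      rintro _ ⟨_, ⟨ψ, hψ, rfl⟩, rfl⟩
      have := Derives.app (Γ := Γ) _ (fun _ => ψ) there fun χ hχ => by
        rw [List.mem_singleton.1 hχ]
        exact .hyp ψ hψ
      simpa only [subst_lam, subst] using this
    refine Derives.app _ (fun _ => φ) back fun χ hχ => ?_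
    rw [List.mem_singleton.1 hχ]
    simpa only [subst_lam, subst] using hσ

/-! ### Terms in one variable on `ŁV_{q+1}` for prime `q` -/

theorem gcd_mem_of_sub_mem {S : Set ℕ} (hS : ∀ a ∈ S, ∀ b ∈ S, a - b ∈ S) {a b : ℕ}
    (ha : a ∈ S) (hb : b ∈ S) : Nat.gcd a b ∈ S := by
  induction h : a + b using Nat.strong_induction_on generalizing a b with
  | _ N ih =>
    rcases Nat.eq_zero_or_pos a with rfl | ha0
    · rwa [Nat.gcd_zero_left]
    rcases Nat.eq_zero_or_pos b with rfl | hb0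
    · rwa [Nat.gcd_zero_right]
    rcases le_total a b with hab | hab
    · rw [← Nat.gcd_sub_self_right hab]
      exact ih _ (by omega) ha (hS b hb a ha) rfl
    · rw [Nat.gcd_comm, ← Nat.gcd_sub_self_right hab]
      exact ih _ (by omega) hb (hS a ha b hb) rfl

/-- A non-Boolean element `k / q` generates the chain: the numerators of the elements that it
generates are closed under truncated subtraction and contain `k` and `q`, hence `gcd k q = 1`. -/
theorem exists_term_of_ne {q : ℕ} (hq : q.Prime) {k : ℕ} (hk0 : 0 < k) (hkq : k < q)
    (c : chain q) : ∃ t : Formula, ∀ v : ℕ → chain q, (v 0).1 = (k : ℚ) / q → eval v t = c := by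
  have hqQ : (0 : ℚ) < q := by exact_mod_cast hq.pos
  let S : Set ℕ := {l | ∃ t : Formula, ∀ v : ℕ → chain q, (v 0).1 = (k : ℚ) / q →
    (eval v t).1 = (l : ℚ) / q}
  have hsub : ∀ a ∈ S, ∀ b ∈ S, a - b ∈ S := by
    rintro a ⟨t, ht⟩ b ⟨s, hs⟩
    refine ⟨neg (imp t s), fun v hv => ?_⟩
    rw [eval_neg, eval_imp, ht v hv, hs v hv]
    rcases le_total a b with h | h
    · have : (a : ℚ) / q ≤ (b : ℚ) / q := by gcongr
      rw [Nat.sub_eq_zero_of_le h, min_eq_left (by linarith)]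
      simp
    · have : (b : ℚ) / q ≤ (a : ℚ) / q := by gcongr
      rw [Nat.cast_sub h, min_eq_right (by linarith)]
      ring
  have hqS : q ∈ S := ⟨imp (var 0) (var 0), fun v _ => by
    rw [eval_imp, div_self hqQ.ne']; simp⟩
  have h1 : 1 ∈ S := by
    have h := gcd_mem_of_sub_mem hsub (a := k) (b := q) ⟨var 0, fun v hv => hv⟩ hqS
    rwa [((Nat.coprime_of_lt_prime hk0.ne' hkq hq).symm : Nat.gcd k q = 1)] at h
  have hall : ∀ l, q - l ∈ S := by
    intro l
    induction l with
    | zero => exact hqS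
    | succ l ih => exact hsub _ ih 1 h1
  obtain ⟨l, hl, hcl⟩ := (mem_chain_iff hq.pos _).1 c.2
  obtain ⟨t, ht⟩ := hall (q - l)
  rw [Nat.sub_sub_self hl] at ht
  exact ⟨t, fun v hv => Subtype.ext ((ht v hv).trans hcl.symm)⟩

/-- The formula that takes the value of `φ` where `δ` is `1` and the value of `ψ` where `δ`
is `0`. -/
def caseFormula (δ φ ψ : Formula) : Formula := Formula.or (Formula.and δ φ) (Formula.and (neg δ) ψ)

theorem eval_caseFormula_one {n : ℕ} (v : ℕ → chain n) {δ φ ψ : Formula} (h : (eval v δ).1 = 1) :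
    eval v (caseFormula δ φ ψ) = eval v φ := by
  apply Subtype.ext
  rw [caseFormula, eval_or, eval_and, eval_and, eval_neg, h, sub_self, min_eq_right (chain_le_one _),
    min_eq_left (chain_nonneg _), max_eq_left (chain_nonneg _)]

theorem eval_caseFormula_zero {n : ℕ} (v : ℕ → chain n) {δ φ ψ : Formula} (h : (eval v δ).1 = 0) :
    eval v (caseFormula δ φ ψ) = eval v ψ := by
  apply Subtype.ext
  rw [caseFormula, eval_or, eval_and, eval_and, eval_neg, h, sub_zero, min_eq_right (chain_le_one _),
    min_eq_left (chain_nonneg _), max_eq_right (chain_nonneg _)]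

/-- Every element of `ŁV_{q+1}` is the value of one term at all non-Boolean arguments. -/
theorem exists_term {q : ℕ} (hq : q.Prime) (c : chain q) :
    ∃ t : Formula, ∀ v : ℕ → chain q, ¬ IsBool (v 0) → eval v t = c := by
  have hqQ : (0 : ℚ) < q := by exact_mod_cast hq.pos
  have key : ∀ N < q, ∃ t : Formula, ∀ v : ℕ → chain q, ∀ k : ℕ, 0 < k → k ≤ N →
      (v 0).1 = (k : ℚ) / q → eval v t = c := by
    intro N
    induction N with
    | zero => exact fun _ => ⟨var 0, fun v k h h' => absurd h (by omega)⟩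
    | succ N ih =>
      intro hN
      obtain ⟨t, ht⟩ := ih (by omega)
      obtain ⟨t', ht'⟩ := exists_term_of_ne hq N.succ_pos hN c
      refine ⟨caseFormula (lam (N + 1) q (var 0)) t' t, fun v k hk hkN hv => ?_⟩
      have hδ := eval_lam_eq_ite hq.pos v (var 0) (N + 1)
      rw [eval_var, hv] at hδ
      simp only [div_le_div_iff_of_pos_right hqQ, Nat.cast_le] at hδ
      rcases eq_or_lt_of_le hkN with rfl | hlt
      · rw [if_pos le_rfl] at hδ
        rw [eval_caseFormula_one v hδ, ht' v hv]
      · rw [if_neg (by omega)] at hδ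
        rw [eval_caseFormula_zero v hδ, ht v k hk (by omega) hv]
  obtain ⟨t, ht⟩ := key (q - 1) (by have := hq.pos; omega)
  refine ⟨t, fun v hv => ?_⟩
  obtain ⟨k, hk0, hkq, hk⟩ := exists_eq_div_of_not_isBool hq.pos hv
  exact ht v k hk0 (by omega) hk

/-- The formula `(φ ∨ ¬φ)^q`: it is `1` where `φ` is Boolean and `0` elsewhere. -/
def boolFormula (q : ℕ) (φ : Formula) : Formula := npow q (Formula.or φ (neg φ))

theorem eval_boolFormula_one {q : ℕ} {v : ℕ → chain q} {φ : Formula} (h : IsBool (eval v φ)) :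
    (eval v (boolFormula q φ)).1 = 1 := by
  rw [boolFormula, eval_npow, eval_or, eval_neg]
  rcases h with h | h <;> rw [h] <;> simp

theorem eval_boolFormula_zero {q : ℕ} (hq : 0 < q) {v : ℕ → chain q} {φ : Formula}
    (h : ¬ IsBool (eval v φ)) : (eval v (boolFormula q φ)).1 = 0 := by
  obtain ⟨k, hk0, hkq, hk⟩ := exists_eq_div_of_not_isBool hq h
  have hqQ : (0 : ℚ) < q := by exact_mod_cast hq
  have h1 : (1 : ℚ) ≤ k := by exact_mod_cast hk0
  have h2 : (k : ℚ) + 1 ≤ q := by exact_mod_cast hkq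
  have hqx : q * (eval v φ).1 = k := by rw [hk]; field_simp
  rw [boolFormula, eval_npow, eval_or, eval_neg]
  refine max_eq_left ?_
  rcases max_choice (eval v φ).1 (1 - (eval v φ).1) with h | h <;> rw [h] <;> linarith

/-- Any two assignments in `ŁV_{q+1}`, the second one Boolean, are glued by a substitution by
formulas in `φ`: it yields `v` where `φ` is not Boolean and `w` where it is. -/
theorem exists_glue {q : ℕ} (hq : q.Prime) (v : ℕ → chain q) {w : ℕ → chain q}
    (hw : ∀ k, IsBool (w k)) (φ : Formula) : ∃ s : ℕ → Formula, ∀ u : ℕ → chain q,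
      (¬ IsBool (eval u φ) → (fun k => eval u (s k)) = v) ∧
      (IsBool (eval u φ) → (fun k => eval u (s k)) = w) := by
  have hconst : ∀ k, ∃ t : Formula, ∀ u : ℕ → chain q, eval u t = w k := by
    intro k
    rcases hw k with h | h
    · exact ⟨neg (imp (var 0) (var 0)), fun u => Subtype.ext (by
        rw [h, eval_neg, eval_imp]; simp)⟩
    · exact ⟨imp (var 0) (var 0), fun u => Subtype.ext (by rw [h, eval_imp]; simp)⟩
  choose b hb using hconst
  choose t ht using fun k => exists_term hq (v k)
  refine ⟨fun k => caseFormula (boolFormula q φ) (b k) (subst (fun _ => φ) (t k)),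
    fun u => ⟨fun h => funext fun k => ?_, fun h => funext fun k => ?_⟩⟩
  · rw [eval_caseFormula_zero u (eval_boolFormula_zero hq.pos h), eval_subst]
    exact ht k _ h
  · rw [eval_caseFormula_one u (eval_boolFormula_one h), hb]

theorem boolFormula_mem_iff {n i : ℕ} (hi : 0 < i) (hin : i ≤ n) (v : ℕ → chain n)
    (φ : Formula) : eval v (boolFormula n φ) ∈ orderFilter n i ↔ IsBool (eval v φ) := by
  by_cases h : IsBool (eval v φ)
  · have h1 := eval_boolFormula_one h
    exact iff_of_true ((IsBool.mem_orderFilter hi hin (Or.inr h1)).2 h1) h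
  · have h0 := eval_boolFormula_zero (hi.trans_le hin) h
    refine iff_of_false (fun h' => ?_) h
    rw [IsBool.mem_orderFilter hi hin (Or.inl h0), h0] at h'
    exact zero_ne_one h'

/-- The premise of the explosion rule holds exactly at the non-Boolean elements. -/
theorem explosion_prem_mem_iff {n i : ℕ} (hi : 0 < i) (hin : i ≤ n) (v : ℕ → chain n)
    (φ : Formula) :
    eval v (nmul i (Formula.and φ (neg φ))) ∈ orderFilter n i ↔ ¬ IsBool (eval v φ) := by
  have hnQ : (0 : ℚ) < n := by exact_mod_cast hi.trans_le hin
  have hiQ : (0 : ℚ) < i := by exact_mod_cast hi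
  have hinQ : (i : ℚ) ≤ n := by exact_mod_cast hin
  rw [orderFilter, Set.mem_ofPred_eq, eval_nmul, eval_and, eval_neg]
  constructor
  · intro h hb
    have h0 : min (eval v φ).1 (1 - (eval v φ).1) = 0 := by
      rcases hb with hb | hb <;> rw [hb] <;> simp
    rw [h0, mul_zero, min_eq_right zero_le_one] at h
    exact absurd h (not_le.2 (div_pos hiQ hnQ))
  · intro h
    obtain ⟨k, hk0, hkn, hk⟩ := exists_eq_div_of_not_isBool (hi.trans_le hin) h
    have h1 : (1 : ℚ) ≤ k := by exact_mod_cast hk0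
    have h2 : (k : ℚ) + 1 ≤ n := by exact_mod_cast hkn
    have hmin : 1 / (n : ℚ) ≤ min (eval v φ).1 (1 - (eval v φ).1) := by
      rw [hk]
      refine le_min (div_le_div_of_nonneg_right h1 hnQ.le) ?_
      rw [le_sub_iff_add_le, ← add_div]
      exact (div_le_one hnQ).2 (by linarith)
    refine le_min ((div_le_one hnQ).2 hinQ) ?_
    rw [div_eq_mul_one_div]
    exact mul_le_mul_of_nonneg_left hmin hiQ.le

/-! ### Classically unsatisfiable sets -/

/-- The formula `⋁_{k < N} (p_k ∧ ¬p_k)`. -/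
def nonBoolFormula : ℕ → Formula
  | 0 => neg (imp (var 0) (var 0))
  | N + 1 => Formula.or (nonBoolFormula N) (Formula.and (var N) (neg (var N)))

theorem eval_nonBoolFormula {n : ℕ} (v : ℕ → chain n) (N : ℕ) :
    (eval v (nonBoolFormula N)).1 ≤ 1 / 2 ∧
      ∀ k < N, min (v k).1 (1 - (v k).1) ≤ (eval v (nonBoolFormula N)).1 := by
  induction N with
  | zero =>
    refine ⟨?_, fun k hk => absurd hk (Nat.not_lt_zero k)⟩
    rw [nonBoolFormula, eval_neg, eval_imp]
    simp
  | succ N ih =>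
    rw [nonBoolFormula, eval_or, eval_and, eval_neg, eval_var]
    refine ⟨max_le ih.1 ?_, fun k hk => ?_⟩
    · rcases le_total (v N).1 (1 / 2) with h | h
      · exact (min_le_left _ _).trans h
      · exact (min_le_right _ _).trans (by linarith)
    · rcases Nat.lt_succ_iff_lt_or_eq.1 hk with h | rfl
      · exact (ih.2 k h).trans (le_max_left _ _)
      · exact le_max_right _ _

theorem not_isBool_nonBoolFormula {n : ℕ} {v : ℕ → chain n} {N k : ℕ} (hk : k < N)
    (hv : ¬ IsBool (v k)) : ¬ IsBool (eval v (nonBoolFormula N)) := by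
  obtain ⟨h₁, h₂⟩ := eval_nonBoolFormula v N
  have h0 : 0 < (v k).1 := lt_of_le_of_ne (chain_nonneg _) fun h => hv (Or.inl h.symm)
  have h1 : (v k).1 < 1 := lt_of_le_of_ne (chain_le_one _) fun h => hv (Or.inr h)
  have hpos := (lt_min h0 (sub_pos.2 h1)).trans_le (h₂ k hk)
  rintro (h | h) <;> linarith

theorem finite_chain {n : ℕ} (hn : 0 < n) : Finite (chain n) := by
  refine Set.Finite.to_subtype
    (((Set.finite_Iic n).image fun k : ℕ => (k : ℚ) / n).subset fun x hx => ?_)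
  obtain ⟨k, hk, rfl⟩ := (mem_chain_iff hn x).1 hx
  exact ⟨k, hk, rfl⟩

theorem continuous_eval {n : ℕ} (hn : 0 < n) (φ : Formula) :
    Continuous fun v : ℕ → chain n => eval v φ := by
  have := finite_chain hn
  induction φ with
  | var k => exact continuous_apply k
  | neg φ ih =>
    have h : Continuous (Alg.neg : chain n → chain n) := continuous_of_discreteTopology
    exact h.comp ih
  | imp φ ψ ih₁ ih₂ =>
    have h : Continuous fun p : chain n × chain n => (Alg.imp p.1 p.2 : chain n) :=
      continuous_of_discreteTopology
    exact Continuous.comp (f := fun v => (eval v φ, eval v ψ)) h (ih₁.prodMk ih₂)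

/-- By compactness of the space of valuations, a classically unsatisfiable set `Γ` forces one
formula to be non-Boolean. -/
theorem exists_forced_not_isBool {n i : ℕ} (hn : 0 < n) {Γ : Set Formula}
    (hΓ : ¬ ∃ w, BoolModel n i Γ w) : ∃ θ : Formula, ∀ v : ℕ → chain n,
      (∀ ψ ∈ Γ, eval v ψ ∈ orderFilter n i) → ¬ IsBool (eval v θ) := by
  have := finite_chain hn
  by_contra! hθ
  let V : ℕ → Set (ℕ → chain n) := fun N =>
    {v | (∀ ψ ∈ Γ, eval v ψ ∈ orderFilter n i) ∧ ∀ k < N, IsBool (v k)}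
  have hclosed : ∀ N, IsClosed (V N) := by
    intro N
    have h₁ : IsClosed {v : ℕ → chain n | ∀ ψ ∈ Γ, eval v ψ ∈ orderFilter n i} := by
      simp only [Set.ofPred_forall]
      exact isClosed_iInter fun ψ => isClosed_iInter fun _ =>
        (isClosed_discrete (orderFilter n i)).preimage (continuous_eval hn ψ)
    have h₂ : IsClosed {v : ℕ → chain n | ∀ k < N, IsBool (v k)} := by
      simp only [Set.ofPred_forall]
      exact isClosed_iInter fun k => isClosed_iInter fun _ =>
        (isClosed_discrete {x : chain n | IsBool x}).preimage
          (f := fun v : ℕ → chain n => v k) (continuous_apply k)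
    exact h₁.inter h₂
  have hne : ∀ N, (V N).Nonempty := by
    intro N
    obtain ⟨v, hv, hvN⟩ := hθ (nonBoolFormula N)
    exact ⟨v, hv, fun k hk => by_contra fun h => not_isBool_nonBoolFormula hk h hvN⟩
  obtain ⟨w, hw⟩ := IsCompact.nonempty_iInter_of_sequence_nonempty_isCompact_isClosed V
    (fun N v hv => ⟨hv.1, fun k hk => hv.2 k (Nat.lt_succ_of_lt hk)⟩) hne
    (hclosed 0).isCompact hclosed
  rw [Set.mem_iInter] at hw
  exact hΓ ⟨w, fun k => (hw (k + 1)).2 k k.lt_succ_self, (hw 0).1⟩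

/-! ### Extensions of `L` by the explosion rule -/

section Extensions

variable {n i : ℕ} (hi : 0 < i) (hin : i ≤ n)
include hi hin

/-- In an extension of `L`, classical consequences hold once all formulas are Boolean. -/
theorem IsLogic.of_CPL {D : Relation} (hD : IsLogic D) (hL : ∀ Γ φ, L n i Γ φ → D Γ φ)
    {Γ : Set Formula} (hbool : ∀ χ, D Γ (boolFormula n χ)) {φ : Formula} (hφ : CPL Γ φ) :
    D Γ φ := by
  refine hD.cut Γ (Γ ∪ Set.range fun k => boolFormula n (var k)) φ ?_ (hL _ _ fun v hv => ?_)
  · rintro ψ (hψ | ⟨k, rfl⟩)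
    · exact hD.refl Γ ψ hψ
    · exact hbool (var k)
  · refine (CPL_iff hi hin Γ φ).1 hφ v ⟨fun k => ?_, fun ψ hψ => hv ψ (Or.inl hψ)⟩
    exact (boolFormula_mem_iff hi hin v (var k)).1 (hv _ (Or.inr ⟨k, rfl⟩))

/-- A logic that extends `L` and contains the explosion rule extends `Lbar`. -/
theorem IsLogic.Lbar_le {D : Relation} (hD : IsLogic D) (hL : ∀ Γ φ, L n i Γ φ → D Γ φ)
    (hexp : ∀ s, D {χ | ∃ φ ∈ (explosionRule n i).prems, χ = subst s φ}
      (subst s (explosionRule n i).concl)) (Γ : Set Formula) (φ : Formula)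
    (h : Lbar n i Γ φ) : D Γ φ := by
  rw [Lbar_iff hi hin] at h
  by_cases hΓ : ∃ w, BoolModel n i Γ w
  · exact hL Γ φ (h hΓ)
  obtain ⟨θ, hθ⟩ := exists_forced_not_isBool (hi.trans_le hin) hΓ
  refine hD.of_CPL hi hin hL (fun χ => ?_) ((CPL_iff hi hin Γ φ).2 fun w hw => (hΓ ⟨w, hw⟩).elim)
  -- The instance of the rule with premise `i (θ ∧ ¬θ)`, which follows from `Γ`.
  have hD' : D Γ (subst (subst₃ θ χ χ) (explosionRule n i).concl) := by
    refine hD.cut _ _ _ ?_ (hexp (subst₃ θ χ χ))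
    rintro _ ⟨ψ, hψ, rfl⟩
    rw [List.mem_singleton.1 hψ]
    refine hL _ _ fun v hv => ?_
    rw [eval_subst, explosion_prem_mem_iff hi hin]
    exact hθ v hv
  refine hD.cut _ _ _ ?_ (hL {subst (subst₃ θ χ χ) (explosionRule n i).concl} _ fun v hv => ?_)
  · rintro _ rfl
    exact hD'
  · have := hv _ rfl
    rw [eval_subst] at this
    rw [boolFormula_mem_iff hi hin]
    exact (boolFormula_mem_iff hi hin (fun k => eval v (subst₃ θ χ χ k)) (var 1)).1 this

theorem explosionRule_validIn_Lbar : (explosionRule n i).ValidIn (Lbar n i) := by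
  refine (Lbar_iff hi hin _ _).2 ?_
  rintro ⟨w, hw, hwΓ⟩
  exact absurd (hw 0) ((explosion_prem_mem_iff hi hin w (var 0)).1
    (hwΓ _ (List.mem_singleton.2 rfl)))

theorem axiomatizes_insert_explosionRule {R : Set Rule} (hR : Axiomatizes R (L n i)) :
    Axiomatizes (insert (explosionRule n i) R) (Lbar n i) := by
  intro Γ φ
  constructor
  · refine (isLogic_matrixLogic _ _).of_derives ?_
    rintro r (rfl | hr)
    · exact explosionRule_validIn_Lbar hi hin
    · exact L_le_Lbar hi hin _ _ ((hR _ _).1 (derives_of_mem hr))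
  · refine (isLogic_derives _).Lbar_le hi hin (fun Γ φ h => ?_) (fun s => ?_) Γ φ
    · exact ((hR Γ φ).2 h).mono_rules (Set.subset_insert _ _)
    · exact (isLogic_derives _).rule_instance (derives_of_mem (Set.mem_insert _ _)) s

end Extensions

/-! ### Strong maximality -/

theorem exists_not_isBool {n : ℕ} (hn : 2 ≤ n) : ∃ x : chain n, ¬ IsBool x := by
  have hnQ : (2 : ℚ) ≤ n := by exact_mod_cast hn
  have h0 : (0 : ℚ) < 1 / n := by positivity
  have h1 : 1 / (n : ℚ) < 1 := (div_lt_one (by linarith)).2 (by linarith)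
  refine ⟨⟨1 / n, h0.le, h1.le, 1, by field_simp; simp⟩, ?_⟩
  rintro (h | h)
  · exact h0.ne' h
  · exact h1.ne h

section Maximality

variable {q j : ℕ} (hq : q.Prime) (hj : 0 < j) (hjq : j ≤ q)
include hq hj hjq

theorem properSublogic_L_Lbar : ProperSublogic (L q j) (Lbar q j) := by
  refine ⟨L_le_Lbar hj hjq, _, _, explosionRule_validIn_Lbar hj hjq, fun h => ?_⟩
  obtain ⟨x, hx⟩ := exists_not_isBool hq.two_le
  refine hx ((boolFormula_mem_iff hj hjq (fun _ => x) (var 1)).1 (h (fun _ => x) fun ψ hψ => ?_))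
  rw [List.mem_singleton.1 hψ]
  exact (explosion_prem_mem_iff hj hjq (fun _ => x) (var 0)).2 hx

theorem properSublogic_Lbar_CPL : ProperSublogic (Lbar q j) CPL := by
  refine ⟨Lbar_le_CPL hj hjq, ∅, boolFormula q (var 0),
    (CPL_iff hj hjq _ _).2 fun w hw => (boolFormula_mem_iff hj hjq w _).2 (hw.1 0), fun h => ?_⟩
  obtain ⟨x, hx⟩ := exists_not_isBool hq.two_le
  have hL := (Lbar_iff hj hjq _ _).1 h
    ⟨fun _ => ⟨1, zero_le_one, le_rfl, q, by simp⟩, fun _ => Or.inr rfl, by simp⟩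
  exact hx ((boolFormula_mem_iff hj hjq (fun _ => x) (var 0)).1 (hL (fun _ => x) (by simp)))

/-- A classically valid rule that fails in `Lbar` has a Boolean model `w` of its premises and a
valuation `v` that refutes it. Gluing `v` and `w` along a formula `χ` turns the premises into
theorems and the conclusion into a formula that forces `χ` to be Boolean. -/
theorem stronglyMaximal_Lbar_CPL : StronglyMaximal (Lbar q j) CPL := by
  refine .intro (isLogic_matrixLogic _ _) (properSublogic_Lbar_CPL hq hj hjq) ?_
  intro r hr₂ hr₁ D hD hle hrD Γ φ hφ
  have hL : ∀ Γ φ, L q j Γ φ → D Γ φ := fun Γ φ h => hle _ _ (L_le_Lbar hj hjq _ _ h)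
  rw [Rule.ValidIn, Lbar_iff hj hjq] at hr₁
  simp only [L, matrixLogic] at hr₁
  push Not at hr₁
  obtain ⟨⟨w, hw⟩, v, hv, hvr⟩ := hr₁
  refine hD.of_CPL hj hjq hL (fun χ => ?_) hφ
  obtain ⟨s, hs⟩ := exists_glue hq v hw.1 χ
  have hψ : D Γ (subst s r.concl) := by
    refine hD.cut _ _ _ ?_ (hrD s)
    rintro _ ⟨ψ, hψ, rfl⟩
    refine hL _ _ fun u _ => ?_
    rw [eval_subst]
    by_cases hu : IsBool (eval u χ)
    · rw [(hs u).2 hu]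
      exact hw.2 ψ hψ
    · rw [(hs u).1 hu]
      exact hv ψ hψ
  refine hD.cut _ {subst s r.concl} _ (by rintro _ rfl; exact hψ) (hL _ _ fun u hu => ?_)
  rw [boolFormula_mem_iff hj hjq]
  by_contra hχ
  have := hu _ rfl
  rw [eval_subst, (hs u).1 hχ] at this
  exact hvr this

/-- A rule that is valid in `Lbar` and fails in `L` under `v` has classically unsatisfiable
premises. A substitution that yields `v` wherever `θ` is not Boolean makes `j (θ ∧ ¬θ)` imply the
premises and contradict the conclusion, so the rule entails the explosion rule. -/
theorem stronglyMaximal_L_Lbar : StronglyMaximal (L q j) (Lbar q j) := by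
  refine .intro (isLogic_matrixLogic _ _) (properSublogic_L_Lbar hq hj hjq) ?_
  intro r hr₂ hr₁ D hD hL hrD
  simp only [Rule.ValidIn, L, matrixLogic] at hr₁
  push Not at hr₁
  obtain ⟨v, hv, hvr⟩ := hr₁
  refine hD.Lbar_le hj hjq hL fun s₀ => ?_
  set P := {χ | ∃ φ ∈ (explosionRule q j).prems, χ = subst s₀ φ}
  have hP : ∀ u : ℕ → chain q, (∀ ψ ∈ P, eval u ψ ∈ orderFilter q j) →
      ¬ IsBool (eval u (s₀ 0)) := by
    intro u hu
    have := hu _ ⟨_, List.mem_singleton.2 rfl, rfl⟩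
    rw [eval_subst] at this
    exact (explosion_prem_mem_iff hj hjq (fun k => eval u (s₀ k)) (var 0)).1 this
  obtain ⟨s, hs⟩ := exists_glue hq v
    (w := fun _ => ⟨1, zero_le_one, le_rfl, q, by simp⟩) (fun _ => Or.inr rfl) (s₀ 0)
  have hψ : D P (subst s r.concl) := by
    refine hD.cut _ _ _ ?_ (hrD s)
    rintro _ ⟨ψ, hψ, rfl⟩
    refine hL _ _ fun u hu => ?_
    rw [eval_subst, (hs u).1 (hP u hu)]
    exact hv ψ hψ
  refine hD.cut _ (insert (subst s r.concl) P) _ ?_ (hL _ _ fun u hu => ?_)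
  · rintro χ (rfl | hχ)
    · exact hψ
    · exact hD.refl P χ hχ
  · have h := hu _ (Set.mem_insert _ _)
    rw [eval_subst, (hs u).1 (hP u fun χ hχ => hu χ (Set.mem_insert_of_mem _ hχ))] at h
    exact absurd h hvr

/-- The extension of `L` by the explosion rule is contained in `Lbar`, hence is not `CPL`. -/
theorem not_stronglyMaximal_L_CPL : ¬ StronglyMaximal (L q j) CPL := by
  intro h
  obtain ⟨Γ, φ, hφ, hφ'⟩ := (properSublogic_Lbar_CPL hq hj hjq).2
  have hvalid := explosionRule_validIn_Lbar hj hjq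
  have hnot : ¬ (explosionRule q j).ValidIn (L q j) := by
    intro hr
    obtain ⟨Δ, ψ, hψ, hψ'⟩ := (properSublogic_L_Lbar hq hj hjq).2
    exact hψ' ((isLogic_matrixLogic _ _).Lbar_le hj hjq (fun _ _ h => h)
      ((isLogic_matrixLogic _ _).rule_instance hr) Δ ψ hψ)
  exact hφ' ((h.2 _ (Lbar_le_CPL hj hjq _ _ hvalid) hnot Γ φ).2 hφ (Lbar q j)
    (isLogic_matrixLogic _ _) (L_le_Lbar hj hjq) ((isLogic_matrixLogic _ _).rule_instance hvalid))

end Maximality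
end LukLogic

theorem mainTheorem6 (q j : ℕ) (hq : q.Prime) (hj : 0 < j) (hjq : j ≤ q) :
    LukLogic.StronglyMaximal (LukLogic.Lbar q j) LukLogic.CPL ∧
    LukLogic.Axiomatizes (LukLogic.H q j) (LukLogic.L q j) ∧
    LukLogic.Axiomatizes (insert (LukLogic.explosionRule q j) (LukLogic.H q j))
      (LukLogic.Lbar q j) ∧
    (∀ R : Set LukLogic.Rule, LukLogic.Axiomatizes R (LukLogic.L q j) →
      LukLogic.Axiomatizes (insert (LukLogic.explosionRule q j) R) (LukLogic.Lbar q j)) ∧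
    LukLogic.StronglyMaximal (LukLogic.L q j) (LukLogic.Lbar q j) ∧
    ¬ LukLogic.StronglyMaximal (LukLogic.L q j) LukLogic.CPL :=
  ⟨LukLogic.stronglyMaximal_Lbar_CPL hq hj hjq, LukLogic.axiomatizes_H hj hjq,
    LukLogic.axiomatizes_insert_explosionRule hj hjq (LukLogic.axiomatizes_H hj hjq),
    fun _ hR => LukLogic.axiomatizes_insert_explosionRule hj hjq hR,
    LukLogic.stronglyMaximal_L_Lbar hq hj hjq, LukLogic.not_stronglyMaximal_L_CPL hq hj hjq⟩
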